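/- Let $(\epsilon_t)$ be an $\mathbb{R}^N$-valued process on a probability space, adapted to a filtration $(\mathcal F_t)$ (non-anticipative), strictly stationary and ergodic. Let $\Theta \subset \mathbb{R}^d$ be convex, not necessarily compact, with $\theta_0$ in its interior, and let $l : \mathbb{R}^N \times \Theta \to \mathbb{R}$ be measurable in its first argument and, for every value of the first argument, strictly convex and $C^\infty$ in $\theta \in \Theta$. Assume: - $l(\epsilon_t;\theta)$ is integrable for every $\theta \in \Theta$, and $\theta \mapsto \mathbb{E}[l(\epsilon_t;\theta)]$ is uniquely minimized over $\Theta$ at $\theta_0$; $(\nabla_\theta l(\epsilon_t;\theta_0))_t$ is a square integrable martingale difference with respect to $(\mathcal F_t)$; - $\mathbb{H} := \mathbb{E}[\nabla^2_{\theta\theta'} l(\epsilon_t;\theta_0)]$ and $\mathbb{M} := \mathbb{E}[\nabla_\theta l(\epsilon_t;\theta_0)\nabla_{\theta'} l(\epsilon_t;\theta_0)]$ exist and are positive definite; - for some constant $C>0$ and some sequence $\nu_T > 0$ with $\nu_T \to 0$, putting $\upsilon_{t}(C) = \sup_{k,l,m}\ \sup_{\theta\in\Theta:\|\theta-\theta_0\|_2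 \le \nu_T C} |\partial^3_{\theta_k\theta_l\theta_m} l(\epsilon_t;\theta)|$, one has $\frac{1}{T^2}\sum_{t,t'=1}^T \mathbb{E}[\upsilon_t(C)\upsilon_{t'}(C)] < \infty$ for every $T \ge 1$. Let the coordinates $\{1,\dots,d\}$ be split into $m$ groups $\mathcal G_1,\dots,\mathcal G_m$ without overlap, write $\theta^{(k)} = (\theta_i)_{i \in \mathcal G_k}$, and let $\alpha_k, \xi_k \ge 0$ be fixed weights, $\lambda_T,\gamma_T \ge 0$ deterministic tuning parameters. Let the random vector $\hat\theta = \hat\theta_T$ be, almost surely for every $T \ge 1$, a minimizer over $\theta \in \Theta$ of $$\frac1T\sum_{t=1}^T l(\epsilon_t;\theta) + \frac{\lambda_T}{T}\sum_{k=1}^m \alpha_k\|\theta^{(k)}\|_1 + \frac{\gamma_T}{T}\sum_{k=1}^m \xi_k\|\theta^{(k)}\|_2 .$$ Suppose that $\gamma_T/T \to 0$, $\gamma_T/\sqrt T \to \infty$ and $\lambda_T/\gamma_T \to \mu_0 \ge 0$ as $T\to\infty$. Define the non-random function on $\mathbb{R}^d$ $$\mathbb{K}_\infty(u) = \tfrac12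 u'\mathbb{H}u + \mu_0\sum_{k=1}^m \alpha_k \sum_{i\in\mathcal G_k}\bigl\{|u_i|\mathbf 1_{\theta_{0,i}=0} + u_i\,\mathrm{sgn}(\theta_{0,i})\mathbf 1_{\theta_{0,i}\neq 0}\bigr\} + \sum_{k=1}^m \xi_k\Bigl\{\|u^{(k)}\|_2\mathbf 1_{\theta_0^{(k)}=0} + \frac{u^{(k)\prime}\theta_0^{(k)}}{\|\theta_0^{(k)}\|_2}\mathbf 1_{\theta_0^{(k)}\ne 0}\Bigr\}.$$ Then $\mathbb{K}_\infty$ is convex and has a unique minimizer $u^*$ over $\mathbb{R}^d$, and $$\frac{T}{\gamma_T}(\hat\theta-\theta_0) \longrightarrow u^* = \arg\min_{u} \mathbb{K}_\infty(u)$$ in distribution, and hence in probability. The normalizing rate is slower than $\sqrt T$: $T/\gamma_T = o(\sqrt T)$. -/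

import Mathlib

open MeasureTheory ProbabilityTheory Filter Topology Asymptotics
open scoped ENNReal Matrix

noncomputable section

namespace SparseGroupLasso

/-- The Euclidean space `ℝⁿ`. -/
abbrev Vec (n : ℕ) : Type := EuclideanSpace ℝ (Fin n)

/-- The `i`-th canonical basis vector of `ℝᵈ`. -/
def stdVec {d : ℕ} (i : Fin d) : Vec d := EuclideanSpace.single i 1

/-! ### Groups of coordinates and the two penalties -/

/-- The subvector `θ⁽ᵏ⁾` of `θ` on the group `G_k = {i | grp i = k}`.
A map `grp : Fin d → Fin m` is the same thing as a splitting of the `d` coordinates into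
`m` groups without overlap. -/
def groupPart {d m : ℕ} (grp : Fin d → Fin m) (θ : Vec d) (k : Fin m) :
    EuclideanSpace ℝ {i : Fin d // grp i = k} :=
  WithLp.toLp 2 fun i => θ i.1

/-- The `ℓ¹` penalty `∑ₖ αₖ ‖θ⁽ᵏ⁾‖₁`. -/
def l1Penalty {d m : ℕ} (grp : Fin d → Fin m) (α : Fin m → ℝ) (θ : Vec d) : ℝ :=
  ∑ k, α k * ∑ i, |groupPart grp θ k i|

/-- The `ℓ¹/ℓ²` penalty `∑ₗ ξₗ ‖θ⁽ˡ⁾‖₂`. -/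
def groupPenalty {d m : ℕ} (grp : Fin d → Fin m) (ξ : Fin m → ℝ) (θ : Vec d) : ℝ :=
  ∑ k, ξ k * ‖groupPart grp θ k‖

/-- The penalized empirical criterion
`T⁻¹ ∑_{t=1}^T l(ε_t; θ) + λ_T T⁻¹ ∑ₖ αₖ ‖θ⁽ᵏ⁾‖₁ + γ_T T⁻¹ ∑ₗ ξₗ ‖θ⁽ˡ⁾‖₂`,
for the sample path `x = (ε_t)` and the tuning parameters `lam = λ_T`, `gam = γ_T`. -/
def penalizedCriterion {N d m : ℕ} (l : Vec N → Vec d → ℝ) (grp : Fin d → Fin m)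
    (α ξ : Fin m → ℝ) (lam gam : ℝ) (T : ℕ) (x : ℕ → Vec N) (θ : Vec d) : ℝ :=
  (1 / (T : ℝ)) * ∑ t ∈ Finset.Icc 1 T, l (x t) θ
    + lam / T * l1Penalty grp α θ + gam / T * groupPenalty grp ξ θ

/-- The limit criterion
`½ u'ℍu + μ₀ ∑ₖ αₖ ∑_{i ∈ G_k} {|uᵢ| 1_{θ₀ᵢ = 0} + uᵢ sgn(θ₀ᵢ) 1_{θ₀ᵢ ≠ 0}}
  + ∑ₗ ξₗ {‖u⁽ˡ⁾‖₂ 1_{θ₀⁽ˡ⁾ = 0} + ⟨u⁽ˡ⁾, θ₀⁽ˡ⁾⟩ / ‖θ₀⁽ˡ⁾‖₂ 1_{θ₀⁽ˡ⁾ ≠ 0}}`. -/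
def limitCriterion {d m : ℕ} (H : Matrix (Fin d) (Fin d) ℝ) (grp : Fin d → Fin m)
    (α ξ : Fin m → ℝ) (μ₀ : ℝ) (θ₀ u : Vec d) : ℝ :=
  (1 / 2) * (u.ofLp ⬝ᵥ (H *ᵥ u.ofLp))
    + μ₀ * ∑ k, α k * ∑ i, (if groupPart grp θ₀ k i = 0 then |groupPart grp u k i|
        else groupPart grp u k i * Real.sign (groupPart grp θ₀ k i))
    + ∑ k, ξ k * (open Classical in if groupPart grp θ₀ k = 0 then ‖groupPart grp u k‖
        else inner ℝ (groupPart grp u k) (groupPart grp θ₀ k) / ‖groupPart grp θ₀ k‖)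

/-! ### Stationary ergodic processes and martingale differences -/

/-- The process `(ε_t)` is strictly stationary and ergodic: its law on the path space is
invariant under the time shift, and shift-invariant events are trivial. -/
def StationaryErgodic {Ω : Type*} [MeasurableSpace Ω] {N : ℕ} (ε : ℕ → Ω → Vec N)
    (P : Measure Ω) : Prop :=
  Ergodic (fun (x : ℕ → Vec N) (t : ℕ) => x (t + 1)) (P.map fun ω t => ε t ω)

/-- `(ξ_t)` is a square integrable martingale difference with respect to the filtration `ℱ`. -/
structure IsSqIntegrableMartingaleDifference {Ω : Type*} [mΩ : MeasurableSpace Ω] {d : ℕ}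
    (ξ : ℕ → Ω → Vec d) (ℱ : Filtration ℕ mΩ) (P : Measure Ω) : Prop where
  adapted : StronglyAdapted ℱ ξ
  memLp : ∀ t, MemLp (ξ t) 2 P
  condExp_eq_zero : ∀ t, P[ξ (t + 1) | ℱ t] =ᵐ[P] 0

/-! ### Derivatives of the loss -/

/-- The score `∇_θ l(x; θ)`. -/
def score {N d : ℕ} (l : Vec N → Vec d → ℝ) (θ : Vec d) (x : Vec N) : Vec d :=
  gradient (l x) θ

/-- The second partial derivative `∂²_{θᵢ θⱼ} l(x; θ)`. -/
def secondDeriv {N d : ℕ} (l : Vec N → Vec d → ℝ) (θ : Vec d) (x : Vec N) (i j : Fin d) : ℝ :=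
  iteratedFDeriv ℝ 2 (l x) θ ![stdVec i, stdVec j]

/-- The third partial derivative `∂³_{θᵢ θⱼ θₖ} l(x; θ)` on the parameter set `Θ`
(the ordinary one at interior points of `Θ`). -/
def thirdDeriv {N d : ℕ} (l : Vec N → Vec d → ℝ) (Θ : Set (Vec d)) (θ : Vec d) (x : Vec N)
    (i j k : Fin d) : ℝ :=
  iteratedFDerivWithin ℝ 3 (l x) Θ θ ![stdVec i, stdVec j, stdVec k]

/-- `ℍ = 𝔼[∇²_{θθ'} l(ε_t; θ₀)]`. -/
def hessianMean {Ω : Type*} [MeasurableSpace Ω] {N d : ℕ} (l : Vec N → Vec d → ℝ)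
    (ε : ℕ → Ω → Vec N) (P : Measure Ω) (θ₀ : Vec d) : Matrix (Fin d) (Fin d) ℝ :=
  Matrix.of fun i j => ∫ ω, secondDeriv l θ₀ (ε 0 ω) i j ∂P

/-- `𝕄 = 𝔼[∇_θ l(ε_t; θ₀) ∇_{θ'} l(ε_t; θ₀)]`. -/
def scoreSecondMoment {Ω : Type*} [MeasurableSpace Ω] {N d : ℕ} (l : Vec N → Vec d → ℝ)
    (ε : ℕ → Ω → Vec N) (P : Measure Ω) (θ₀ : Vec d) : Matrix (Fin d) (Fin d) ℝ :=
  Matrix.of fun i j => ∫ ω, score l θ₀ (ε 0 ω) i * score l θ₀ (ε 0 ω) j ∂P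

/-- The supremum of `|∂³_{θᵢ θⱼ θₖ} l(x; θ)|` over all `i, j, k` and all `θ ∈ Θ` with
`‖θ - θ₀‖₂ ≤ r`, as an element of `[0, ∞]`. -/
def thirdDerivSup {N d : ℕ} (l : Vec N → Vec d → ℝ) (Θ : Set (Vec d)) (θ₀ : Vec d) (r : ℝ)
    (x : Vec N) : ℝ≥0∞ :=
  ⨆ (i : Fin d) (j : Fin d) (k : Fin d) (θ ∈ Metric.closedBall θ₀ r ∩ Θ),
    ENNReal.ofReal |thirdDeriv l Θ θ x i j k|

/-- `η = T⁻² ∑_{t,t'=1}^T 𝔼[υ_t υ_{t'}]`, where `υ_t` is the supremum of the third derivatives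
of `l(ε_t; ·)` over the ball of radius `r` about `θ₀`. -/
def thirdDerivMoment {Ω : Type*} [MeasurableSpace Ω] {N d : ℕ} (l : Vec N → Vec d → ℝ)
    (Θ : Set (Vec d)) (θ₀ : Vec d) (ε : ℕ → Ω → Vec N) (P : Measure Ω) (r : ℝ) (T : ℕ) : ℝ≥0∞ :=
  ((T : ℝ≥0∞) ^ 2)⁻¹ * ∑ t ∈ Finset.Icc 1 T, ∑ t' ∈ Finset.Icc 1 T,
    ∫⁻ ω, thirdDerivSup l Θ θ₀ r (ε t ω) * thirdDerivSup l Θ θ₀ r (ε t' ω) ∂P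

end SparseGroupLasso

end

/-!
Write `r = γ_T / T` and pass to the local parameter `u = r⁻¹ (θ - θ₀)`. The centered and rescaled
criterion `localCriterion` is convex in `u` on the set where `θ₀ + r u ∈ Θ`, which eventually
contains every given point, and it is minimized at `r⁻¹ (θ̂ - θ₀)`. It therefore suffices to prove
that it converges in `L¹` at each fixed `u` to the limit criterion: for convex functions, closeness
to a continuous function with a strict minimizer at finitely many well-chosen points already forces
the minimizers to be close (`exists_finset_forall_isMinOn_norm_sub_lt`), and finitely many points
are controlled by a union bound (`tendstoInMeasure_argmin_of_convexOn`). No consistency of `θ̂` and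
no compactness of `Θ` is needed.

The pointwise limit comes from a second order Taylor expansion (`localCriterion_eq`).

* The score contributes `γ_T⁻¹ ∑ ⟨∇l(ε_t; θ₀), u⟩`, a sum of orthogonal terms with second moment of
  order `T / γ_T² → 0` (`tendsto_eLpNorm_martingaleDifference_sum`). This is why the limit is not
  random.
* The Hessian contributes an ergodic average, which converges to `½ u'ℍu`. Mathlib provides the von
  Neumann ergodic theorem, from which the `L¹` statement follows by density
  (`tendsto_eLpNorm_birkhoffAverage_sub_integral`).
* The remainder is bounded by `r` times an average of the suprema of the third derivatives over a
  fixed ball, hence tends to `0` (`tendsto_eLpNorm_taylorRemainder_average`). At one large index the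
  moment condition makes this supremum integrable on a ball inside `Θ`, and by stationarity one time
  point suffices.
* The increments of the penalties are difference quotients with step `r → 0⁺`, so they converge to
  one-sided directional derivatives of norms (`tendsto_normDirDeriv`).

The limit criterion is a positive definite quadratic form plus a convex function of at most linear
growth, so it has exactly one minimizer (`exists_strict_min_limitCriterion`).
-/

namespace SparseGroupLasso

/-! ### Stability of the minimizer of a convex function -/

/-- Closeness at finitely many points controls the minimizers of a convex function. If `K` is
continuous with strict global minimizer `u₀`, then every convex `f` that is close enough to `K` on a
suitable finite set has all its minimizers near `u₀`. The finite set consists of `u₀`, the vertices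
of a polytope around `u₀`, which bound `f` from above, and a fine net of the sphere of radius `δ`:
by convexity, a point of the sphere where `f` is small, and an upper bound for `f` beyond it, would
force `f` to be small at a point of the net. -/
theorem exists_finset_forall_isMinOn_norm_sub_lt {E : Type*} [NormedAddCommGroup E]
    [NormedSpace ℝ E] [FiniteDimensional ℝ E] {K : E → ℝ} (hK : Continuous K) {u₀ : E}
    (hmin : ∀ u, u ≠ u₀ → K u₀ < K u) {δ : ℝ} (hδ : 0 < δ) :
    ∃ F : Finset E, ∃ η : ℝ, 0 < η ∧ ∀ (f : E → ℝ) (S : Set E), ConvexOn ℝ S f → ↑F ⊆ S →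
      (∀ p ∈ F, |f p - K p| ≤ η) → ∀ v ∈ S, IsMinOn f S v → ‖v - u₀‖ < δ := by
  classical
  have : ProperSpace E := FiniteDimensional.proper ℝ E
  have hsph : IsCompact (Metric.sphere u₀ δ) := isCompact_sphere _ _
  obtain ⟨η, hη, hgap⟩ : ∃ η : ℝ, 0 < η ∧ ∀ w ∈ Metric.sphere u₀ δ, K u₀ + 4 * η ≤ K w := by
    rcases (Metric.sphere u₀ δ).eq_empty_or_nonempty with h | h
    · exact ⟨1, one_pos, by simp [h]⟩
    · obtain ⟨w, hw, hwmin⟩ := hsph.exists_isMinOn h hK.continuousOn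
      have hne : w ≠ u₀ := by
        rintro rfl
        simp [hδ.ne] at hw
      refine ⟨(K w - K u₀) / 4, by linarith [hmin w hne], fun w' hw' => ?_⟩
      have := hwmin hw'
      simp only [Set.mem_ofPred_eq] at this
      linarith
  obtain ⟨B, hB, -⟩ :=
    (convex_closedBall u₀ (2 * δ)).exists_subset_interior_convexHull_finset_of_isCompact
      (isCompact_closedBall u₀ (2 * δ)) (t := Set.univ) Filter.univ_mem
  obtain ⟨M, hM⟩ : ∃ M : ℝ, ∀ b ∈ B, K b + η ≤ M := by
    obtain ⟨M, hM⟩ := (B.image fun b => K b + η).bddAbove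
    exact ⟨M, fun b hb => hM (by simpa using ⟨b, hb, rfl⟩)⟩
  -- the weight `s` is so small that the bound `M` beyond the sphere does not matter
  obtain ⟨s, hs0, hs1, hsM⟩ : ∃ s : ℝ, 0 < s ∧ s < 1 ∧ s * (M - (K u₀ + η)) ≤ η := by
    refine ⟨min (1 / 2) (η / (1 + |M - (K u₀ + η)|)), by positivity,
      (min_le_left _ _).trans_lt (by norm_num), ?_⟩
    have h1 : 0 < 1 + |M - (K u₀ + η)| := by positivity
    calc _ ≤ min (1 / 2) (η / (1 + |M - (K u₀ + η)|)) * (1 + |M - (K u₀ + η)|) := by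
          gcongr
          linarith [le_abs_self (M - (K u₀ + η))]
      _ ≤ η / (1 + |M - (K u₀ + η)|) * (1 + |M - (K u₀ + η)|) := by
          gcongr
          exact min_le_right _ _
      _ = η := by field_simp
  obtain ⟨t, htS, htfin, htcov⟩ := hsph.finite_cover_balls (e := s * δ) (by positivity)
  refine ⟨insert u₀ (B ∪ htfin.toFinset), η, hη, fun f S hf hFS hfK v hvS hv => ?_⟩
  by_contra! hfar
  have hu₀S : u₀ ∈ S := hFS (by simp)
  have hBS : (B : Set E) ⊆ S := fun b hb => hFS (by simp_all)
  have hupper : ∀ q ∈ Metric.closedBall u₀ (2 * δ), q ∈ S ∧ f q ≤ M := by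
    intro q hq
    have hqB := interior_subset (hB hq)
    refine ⟨convexHull_min hBS hf.1 hqB, ?_⟩
    obtain ⟨b, hb, hqb⟩ := hf.exists_ge_of_mem_convexHull hBS hqB
    have := (abs_le.1 (hfK b (by simp_all))).2
    linarith [hM b hb]
  have hfu₀ : f u₀ ≤ K u₀ + η := by
    have := (abs_le.1 (hfK u₀ (by simp))).2
    linarith
  -- the point `w` where the segment from `u₀` to `v` meets the sphere
  have hnpos : 0 < ‖v - u₀‖ := hδ.trans_le hfar
  set w : E := u₀ + (δ / ‖v - u₀‖) • (v - u₀) with hw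
  have hwsph : w ∈ Metric.sphere u₀ δ := by
    simp [hw, norm_smul, abs_of_pos hδ, hnpos.ne']
  have hc : δ / ‖v - u₀‖ ≤ 1 := (div_le_one hnpos).2 hfar
  have hwS : w ∈ S := hf.1.add_smul_sub_mem hu₀S hvS ⟨by positivity, hc⟩
  have hfw : f w ≤ K u₀ + η := by
    have hcv := hf.2 hu₀S hvS (sub_nonneg.2 hc) (by positivity : 0 ≤ δ / ‖v - u₀‖) (by ring)
    have hweq : (1 - δ / ‖v - u₀‖) • u₀ + (δ / ‖v - u₀‖) • v = w := by
      rw [hw]; module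
    rw [hweq] at hcv
    have hvu : f v ≤ f u₀ := hv hu₀S
    have : δ / ‖v - u₀‖ * f v ≤ δ / ‖v - u₀‖ * f u₀ := by gcongr
    simp only [smul_eq_mul] at hcv
    nlinarith
  obtain ⟨p, hpt, hpw⟩ := Set.mem_iUnion₂.1 (htcov hwsph)
  have hfp : K u₀ + 3 * η ≤ f p := by
    have := (abs_le.1 (hfK p (by simp [hpt]))).1
    linarith [hgap p (htS hpt)]
  -- `p` lies between `w` and the point `q`, which is still in the polytope
  set q : E := w + s⁻¹ • (p - w) with hq
  have hqball : q ∈ Metric.closedBall u₀ (2 * δ) := by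
    have h1 : ‖w - u₀‖ = δ := by simpa [dist_eq_norm] using hwsph
    have h2 : ‖p - w‖ ≤ s * δ := by
      rw [← norm_neg, neg_sub, ← dist_eq_norm]; exact (Metric.mem_ball.1 hpw).le
    rw [mem_closedBall_iff_norm]
    calc ‖q - u₀‖ = ‖(w - u₀) + s⁻¹ • (p - w)‖ := by rw [hq]; congr 1; abel
      _ ≤ ‖w - u₀‖ + ‖s⁻¹ • (p - w)‖ := norm_add_le _ _
      _ ≤ δ + s⁻¹ * (s * δ) := by
          rw [norm_smul, Real.norm_of_nonneg (inv_nonneg.2 hs0.le)]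
          gcongr
          exact h1.le
      _ = 2 * δ := by field_simp; ring
  obtain ⟨hqS, hfq⟩ := hupper q hqball
  have hpq : (1 - s) • w + s • q = p := by
    rw [hq, smul_add s w, smul_smul s, mul_inv_cancel₀ hs0.ne']; module
  have := hf.2 hwS hqS (sub_nonneg.2 hs1.le) hs0.le (by ring)
  rw [hpq] at this
  simp only [smul_eq_mul] at this
  nlinarith

/-- Convergence in probability of minimizers: if random convex functions converge in `L¹` at each
point to a continuous function `K` with strict global minimizer `u₀`, then their minimizers converge
in probability to `u₀`. The domains need only contain each point eventually. -/
theorem tendstoInMeasure_argmin_of_convexOn {Ω E : Type*} [MeasurableSpace Ω] {P : Measure Ω}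
    [NormedAddCommGroup E] [NormedSpace ℝ E] [FiniteDimensional ℝ E] {K : E → ℝ}
    (hK : Continuous K) {u₀ : E} (hmin : ∀ u, u ≠ u₀ → K u₀ < K u) {f : ℕ → Ω → E → ℝ}
    {S : ℕ → Set E} {v : ℕ → Ω → E} (hf : ∀ n ω, ConvexOn ℝ (S n) (f n ω))
    (hS : ∀ p, ∀ᶠ n in atTop, p ∈ S n) (hmeas : ∀ p, ∀ᶠ n in atTop, Measurable fun ω => f n ω p)
    (hconv : ∀ p, Tendsto (fun n => eLpNorm (fun ω => f n ω p - K p) 1 P) atTop (𝓝 0))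
    (hv : ∀ᶠ n in atTop, ∀ᵐ ω ∂P, v n ω ∈ S n ∧ IsMinOn (f n ω) (S n) (v n ω)) :
    TendstoInMeasure P v atTop fun _ => u₀ := by
  rw [tendstoInMeasure_iff_norm]
  intro δ hδ
  obtain ⟨F, η, hη, hF⟩ := exists_finset_forall_isMinOn_norm_sub_lt hK hmin hδ
  have hη' : ENNReal.ofReal η ≠ 0 := (ENNReal.ofReal_pos.2 hη).ne'
  have hsum : Tendsto (fun n => ∑ p ∈ F, (ENNReal.ofReal η)⁻¹
      * eLpNorm (fun ω => f n ω p - K p) 1 P) atTop (𝓝 0) := by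
    have := tendsto_finsetSum F fun p _ => ENNReal.Tendsto.const_mul (hconv p)
      (Or.inr (ENNReal.inv_ne_top.2 hη'))
    simpa using this
  have hFmeas := (Finset.eventually_all F).2 fun p _ => hmeas p
  have hFS := (Finset.eventually_all F).2 fun p _ => hS p
  refine tendsto_of_tendsto_of_tendsto_of_le_of_le' tendsto_const_nhds hsum
    (Eventually.of_forall fun _ => zero_le) ?_
  filter_upwards [hFmeas, hFS, hv] with n hFm hFSn hvn
  calc P {ω | δ ≤ ‖v n ω - u₀‖}
      ≤ P (⋃ p ∈ F, {ω | ENNReal.ofReal η ≤ ‖f n ω p - K p‖ₑ}) := by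
        refine measure_mono_ae ?_
        filter_upwards [hvn] with ω hω
        intro hfar
        by_contra hnear
        have hclose : ∀ p ∈ F, |f n ω p - K p| ≤ η := by
          intro p hp
          by_contra! hlt
          refine hnear (Set.mem_iUnion₂.2 ⟨p, hp, ?_⟩)
          change ENNReal.ofReal η ≤ _
          rw [← ofReal_norm, Real.norm_eq_abs]
          exact ENNReal.ofReal_le_ofReal hlt.le
        exact (hF _ _ (hf n ω) hFSn hclose _ hω.1 hω.2).not_ge hfar
    _ ≤ ∑ p ∈ F, P {ω | ENNReal.ofReal η ≤ ‖f n ω p - K p‖ₑ} := measure_biUnion_finset_le _ _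
    _ ≤ _ := by
        refine Finset.sum_le_sum fun p hp => ?_
        rw [eLpNorm_one_eq_lintegral_enorm, mul_comm, ← div_eq_mul_inv]
        exact meas_ge_le_lintegral_div ((hFm p hp).sub_const _).enorm.aemeasurable hη'
          ENNReal.ofReal_ne_top

/-! ### The limit criterion -/

lemma convexOn_univ_sum {E ι : Type*} [AddCommGroup E] [Module ℝ E] [Fintype ι] {f : ι → E → ℝ}
    (hf : ∀ i, ConvexOn ℝ Set.univ (f i)) : ConvexOn ℝ Set.univ fun x => ∑ i, f i x := by
  refine ⟨convex_univ, fun x _ y _ a b ha hb hab => ?_⟩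
  simp only [smul_eq_mul, Finset.mul_sum, ← Finset.sum_add_distrib]
  exact Finset.sum_le_sum fun i _ => (hf i).2 trivial trivial ha hb hab

section Norm

variable {E : Type*} [NormedAddCommGroup E] [InnerProductSpace ℝ E]

/-- The one-sided derivative of the norm at `a` in the direction `b`, in closed form. The norm is
differentiable away from `0`, and at `0` the one-sided derivative is the norm itself. -/
noncomputable def normDirDeriv (a b : E) : ℝ :=
  open Classical in if a = 0 then ‖b‖ else inner ℝ b a / ‖a‖

lemma tendsto_normDirDeriv (a b : E) :
    Tendsto (fun r : ℝ => r⁻¹ * (‖a + r • b‖ - ‖a‖)) (𝓝[>] 0) (𝓝 (normDirDeriv a b)) := by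
  unfold normDirDeriv
  split_ifs with ha
  · refine tendsto_const_nhds.congr' ?_
    filter_upwards [self_mem_nhdsWithin] with r hr
    have hr : 0 < r := hr
    simp [ha, norm_smul, abs_of_pos hr, hr.ne']
  · have h1 : HasDerivAt (fun r : ℝ => a + r • b) b 0 := by
      simpa using ((hasDerivAt_id (0 : ℝ)).smul_const b).const_add a
    have h2 := h1.norm_sq.sqrt (by simpa using ha)
    have h3 := (hasDerivAt_iff_tendsto_slope_zero.1 h2).mono_left
      (nhdsWithin_mono 0 (fun x hx => ne_of_gt hx : Set.Ioi (0 : ℝ) ⊆ {0}ᶜ))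
    have hna : ‖a‖ ≠ 0 := by simpa using ha
    convert h3 using 2
    · simp
    · simp [real_inner_comm]
      field_simp

lemma convexOn_normDirDeriv (a : E) : ConvexOn ℝ Set.univ (normDirDeriv a) := by
  unfold normDirDeriv
  split_ifs with ha
  · exact convexOn_univ_norm
  · refine ⟨convex_univ, fun x _ y _ s t _ _ _ => le_of_eq ?_⟩
    simp only [inner_add_left, real_inner_smul_left, smul_eq_mul]
    ring

lemma continuous_normDirDeriv (a : E) : Continuous (normDirDeriv a) := by
  unfold normDirDeriv
  split_ifs <;> fun_prop

lemma abs_normDirDeriv_le (a b : E) : |normDirDeriv a b| ≤ ‖b‖ := by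
  unfold normDirDeriv
  split_ifs with ha
  · simp
  · rw [abs_div, abs_norm, div_le_iff₀ (by simpa using ha)]
    exact abs_real_inner_le_norm b a

lemma normDirDeriv_real (a b : ℝ) :
    normDirDeriv a b = if a = 0 then |b| else b * Real.sign a := by
  unfold normDirDeriv
  split_ifs with ha
  · simp
  · rcases lt_or_gt_of_ne ha with h | h
    · rw [Real.sign_of_neg h, Real.norm_of_nonpos h.le]; simp; field_simp
    · rw [Real.sign_of_pos h, Real.norm_of_nonneg h.le]; simp; field_simp

end Norm

section Limit

variable {d m : ℕ} (grp : Fin d → Fin m) (α ξ : Fin m → ℝ) (μ₀ : ℝ) (θ₀ u v : Vec d)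

lemma groupPart_add (k : Fin m) : groupPart grp (u + v) k = groupPart grp u k + groupPart grp v k :=
  rfl

lemma groupPart_smul (c : ℝ) (k : Fin m) : groupPart grp (c • u) k = c • groupPart grp u k :=
  rfl

/-- The map `u ↦ u⁽ᵏ⁾` as a linear map. -/
def groupPartₗ (k : Fin m) : Vec d →ₗ[ℝ] EuclideanSpace ℝ {i : Fin d // grp i = k} where
  toFun u := groupPart grp u k
  map_add' _ _ := rfl
  map_smul' _ _ := rfl

lemma continuous_groupPart (k : Fin m) : Continuous fun u : Vec d => groupPart grp u k := by
  unfold groupPart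
  fun_prop

lemma norm_groupPart_le (k : Fin m) : ‖groupPart grp u k‖ ≤ ‖u‖ := by
  rw [EuclideanSpace.norm_eq, EuclideanSpace.norm_eq]
  apply Real.sqrt_le_sqrt
  change ∑ i : {i // grp i = k}, ‖u i.1‖ ^ 2 ≤ _
  rw [← Finset.sum_subtype (Finset.univ.filter fun i => grp i = k) (by simp)
    (fun i => ‖u i‖ ^ 2)]
  exact Finset.sum_le_univ_sum_of_nonneg fun i => by positivity

/-- The one-sided derivative at `θ₀` of the penalty `u ↦ μ₀ ∑ₖ αₖ ‖u⁽ᵏ⁾‖₁ + ∑ₖ ξₖ ‖u⁽ᵏ⁾‖₂` in the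
direction `u`. -/
noncomputable def penaltyDirDeriv : ℝ :=
  μ₀ * ∑ k, α k * ∑ i, normDirDeriv (groupPart grp θ₀ k i) (groupPart grp u k i)
    + ∑ k, ξ k * normDirDeriv (groupPart grp θ₀ k) (groupPart grp u k)

lemma limitCriterion_eq (H : Matrix (Fin d) (Fin d) ℝ) :
    limitCriterion H grp α ξ μ₀ θ₀ u =
      (1 / 2) * (u.ofLp ⬝ᵥ (H *ᵥ u.ofLp)) + penaltyDirDeriv grp α ξ μ₀ θ₀ u := by
  simp only [limitCriterion, penaltyDirDeriv, normDirDeriv_real, add_assoc]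
  simp only [normDirDeriv]
  congr!

/-- The coordinatewise absolute values are norms on `ℝ`, so the `ℓ¹` penalty is treated like the
group penalty. -/
lemma tendsto_l1Penalty_slope :
    Tendsto (fun r : ℝ => r⁻¹ * (l1Penalty grp α (θ₀ + r • u) - l1Penalty grp α θ₀)) (𝓝[>] 0)
      (𝓝 (∑ k, α k * ∑ i, normDirDeriv (groupPart grp θ₀ k i) (groupPart grp u k i))) := by
  have h : ∀ r : ℝ, r⁻¹ * (l1Penalty grp α (θ₀ + r • u) - l1Penalty grp α θ₀)
      = ∑ k, α k * ∑ i, r⁻¹ * (‖groupPart grp θ₀ k i + r • groupPart grp u k i‖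
        - ‖groupPart grp θ₀ k i‖) := fun r => by
    simp only [l1Penalty, Finset.mul_sum, ← Finset.sum_sub_distrib]
    refine Finset.sum_congr rfl fun k _ => Finset.sum_congr rfl fun i _ => ?_
    rw [groupPart_add, groupPart_smul]
    simp only [PiLp.add_apply, PiLp.smul_apply, Real.norm_eq_abs]
    ring
  simp only [h]
  exact tendsto_finsetSum _ fun k _ => (tendsto_finsetSum _ fun i _ =>
    tendsto_normDirDeriv _ _).const_mul _

lemma tendsto_groupPenalty_slope :
    Tendsto (fun r : ℝ => r⁻¹ * (groupPenalty grp ξ (θ₀ + r • u) - groupPenalty grp ξ θ₀)) (𝓝[>] 0)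
      (𝓝 (∑ k, ξ k * normDirDeriv (groupPart grp θ₀ k) (groupPart grp u k))) := by
  have h : ∀ r : ℝ, r⁻¹ * (groupPenalty grp ξ (θ₀ + r • u) - groupPenalty grp ξ θ₀)
      = ∑ k, ξ k * (r⁻¹ * (‖groupPart grp θ₀ k + r • groupPart grp u k‖
        - ‖groupPart grp θ₀ k‖)) := fun r => by
    simp only [groupPenalty, Finset.mul_sum, ← Finset.sum_sub_distrib]
    refine Finset.sum_congr rfl fun k _ => ?_
    rw [groupPart_add, groupPart_smul]
    ring
  simp only [h]
  exact tendsto_finsetSum _ fun k _ => (tendsto_normDirDeriv _ _).const_mul _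

lemma convexOn_l1Penalty (hα : ∀ k, 0 ≤ α k) : ConvexOn ℝ Set.univ (l1Penalty grp α) := by
  refine convexOn_univ_sum fun k => ConvexOn.smul (hα k) <| convexOn_univ_sum fun i => ?_
  exact (convexOn_univ_norm (E := ℝ)).comp_linearMap
    (EuclideanSpace.proj (𝕜 := ℝ) i.1).toLinearMap

lemma convexOn_groupPenalty (hξ : ∀ k, 0 ≤ ξ k) : ConvexOn ℝ Set.univ (groupPenalty grp ξ) :=
  convexOn_univ_sum fun k => ConvexOn.smul (hξ k) <|
    convexOn_univ_norm.comp_linearMap (groupPartₗ grp k)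

lemma convexOn_penaltyDirDeriv (hα : ∀ k, 0 ≤ α k) (hξ : ∀ k, 0 ≤ ξ k) (hμ₀ : 0 ≤ μ₀) :
    ConvexOn ℝ Set.univ (penaltyDirDeriv grp α ξ μ₀ θ₀) := by
  refine ConvexOn.add (ConvexOn.smul hμ₀ <| convexOn_univ_sum fun k => ConvexOn.smul (hα k) <|
    convexOn_univ_sum fun i => ?_) (convexOn_univ_sum fun k => ConvexOn.smul (hξ k) ?_)
  · exact (convexOn_normDirDeriv _).comp_linearMap
      (EuclideanSpace.proj (𝕜 := ℝ) i.1).toLinearMap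
  · exact (convexOn_normDirDeriv _).comp_linearMap (groupPartₗ grp k)

lemma continuous_penaltyDirDeriv : Continuous (penaltyDirDeriv grp α ξ μ₀ θ₀) := by
  have h1 : ∀ k i, Continuous fun u : Vec d =>
      normDirDeriv (groupPart grp θ₀ k i) (groupPart grp u k i) := fun k i =>
    (continuous_normDirDeriv _).comp ((EuclideanSpace.proj (𝕜 := ℝ) i.1).continuous)
  have h2 : ∀ k, Continuous fun u : Vec d =>
      normDirDeriv (groupPart grp θ₀ k) (groupPart grp u k) := fun k =>
    (continuous_normDirDeriv _).comp (continuous_groupPart grp k)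
  unfold penaltyDirDeriv
  fun_prop

lemma exists_le_penaltyDirDeriv (hα : ∀ k, 0 ≤ α k) (hξ : ∀ k, 0 ≤ ξ k) (hμ₀ : 0 ≤ μ₀) :
    ∃ c, ∀ u, -(c * ‖u‖) ≤ penaltyDirDeriv grp α ξ μ₀ θ₀ u := by
  refine ⟨μ₀ * ∑ k, α k * ∑ i : {i // grp i = k}, 1 + ∑ k, ξ k, fun u => ?_⟩
  have h1 : ∀ k i, -‖u‖ ≤ normDirDeriv (groupPart grp θ₀ k i) (groupPart grp u k i) := fun k i =>
    (neg_le_neg ((PiLp.norm_apply_le (groupPart grp u k) i).trans (norm_groupPart_le grp u k))).trans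
      (neg_le_of_abs_le (abs_normDirDeriv_le _ _))
  have h2 : ∀ k, -‖u‖ ≤ normDirDeriv (groupPart grp θ₀ k) (groupPart grp u k) := fun k =>
    (neg_le_neg (norm_groupPart_le grp u k)).trans (neg_le_of_abs_le (abs_normDirDeriv_le _ _))
  calc _ = μ₀ * ∑ k, α k * ∑ i : {i // grp i = k}, (-‖u‖) + ∑ k, ξ k * (-‖u‖) := by
        simp only [Finset.sum_const, nsmul_eq_mul, mul_neg, Finset.sum_neg_distrib, mul_one,
          ← Finset.sum_mul, ← mul_assoc]
        ring
    _ ≤ _ := by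
        unfold penaltyDirDeriv
        gcongr with k _ i _ k _
        · exact hα k
        · exact h1 k i
        · exact hξ k
        · exact h2 k

/-- The defect of convexity of a quadratic form; no symmetry of `H` is needed. -/
lemma quadForm_convexCombo (H : Matrix (Fin d) (Fin d) ℝ) {s t : ℝ} (hst : s + t = 1) :
    (s • u + t • v).ofLp ⬝ᵥ (H *ᵥ (s • u + t • v).ofLp) =
      s * (u.ofLp ⬝ᵥ (H *ᵥ u.ofLp)) + t * (v.ofLp ⬝ᵥ (H *ᵥ v.ofLp))
        - s * t * ((u - v).ofLp ⬝ᵥ (H *ᵥ (u - v).ofLp)) := by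
  obtain rfl : s = 1 - t := by linarith
  simp only [WithLp.ofLp_add, WithLp.ofLp_smul, WithLp.ofLp_sub, Matrix.mulVec_add,
    Matrix.mulVec_smul, Matrix.mulVec_sub, dotProduct_add, add_dotProduct, sub_dotProduct,
    dotProduct_sub, smul_dotProduct, dotProduct_smul, smul_eq_mul]
  ring

lemma quadForm_smul (H : Matrix (Fin d) (Fin d) ℝ) (c : ℝ) :
    (c • u).ofLp ⬝ᵥ (H *ᵥ (c • u).ofLp) = c ^ 2 * (u.ofLp ⬝ᵥ (H *ᵥ u.ofLp)) := by
  simp only [WithLp.ofLp_smul, Matrix.mulVec_smul, smul_dotProduct, dotProduct_smul, smul_eq_mul]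
  ring

variable {H : Matrix (Fin d) (Fin d) ℝ}

lemma quadForm_pos (hH : H.PosDef) {u : Vec d} (hu : u ≠ 0) : 0 < u.ofLp ⬝ᵥ (H *ᵥ u.ofLp) := by
  simpa using hH.dotProduct_mulVec_pos (x := u.ofLp) (by simpa using hu)

lemma continuous_quadForm : Continuous fun u : Vec d => u.ofLp ⬝ᵥ (H *ᵥ u.ofLp) := by
  fun_prop

lemma exists_mul_norm_sq_le_quadForm (hH : H.PosDef) :
    ∃ c, 0 < c ∧ ∀ u : Vec d, c * ‖u‖ ^ 2 ≤ u.ofLp ⬝ᵥ (H *ᵥ u.ofLp) := by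
  rcases (Metric.sphere (0 : Vec d) 1).eq_empty_or_nonempty with h | h
  · refine ⟨1, one_pos, fun u => ?_⟩
    have hu : u = 0 := by
      by_contra hu
      have : (‖u‖⁻¹ • u) ∈ Metric.sphere (0 : Vec d) 1 := by
        simp [norm_smul, norm_ne_zero_iff.2 hu]
      simp [h] at this
    simp [hu]
  · obtain ⟨w, hw, hmin⟩ := (isCompact_sphere (0 : Vec d) 1).exists_isMinOn h
      (continuous_quadForm (H := H)).continuousOn
    have hw0 : w ≠ 0 := by
      rintro rfl
      simp at hw
    refine ⟨_, quadForm_pos hH hw0, fun u => ?_⟩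
    rcases eq_or_ne u 0 with rfl | hu
    · simp
    have hnu : ‖u‖ ≠ 0 := norm_ne_zero_iff.2 hu
    have h1 := hmin (show ‖u‖⁻¹ • u ∈ Metric.sphere (0 : Vec d) 1 by simp [norm_smul, hnu])
    simp only [Set.mem_ofPred_eq, quadForm_smul] at h1
    calc _ ≤ (‖u‖⁻¹) ^ 2 * (u.ofLp ⬝ᵥ (H *ᵥ u.ofLp)) * ‖u‖ ^ 2 := by gcongr
      _ = _ := by field_simp

lemma continuous_limitCriterion : Continuous (limitCriterion H grp α ξ μ₀ θ₀) := by
  simp only [funext (limitCriterion_eq grp α ξ μ₀ θ₀ · H)]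
  exact (continuous_quadForm.const_mul _).add (continuous_penaltyDirDeriv grp α ξ μ₀ θ₀)

lemma strictConvexOn_limitCriterion (hH : H.PosDef) (hα : ∀ k, 0 ≤ α k) (hξ : ∀ k, 0 ≤ ξ k)
    (hμ₀ : 0 ≤ μ₀) : StrictConvexOn ℝ Set.univ (limitCriterion H grp α ξ μ₀ θ₀) := by
  simp only [funext (limitCriterion_eq grp α ξ μ₀ θ₀ · H)]
  refine StrictConvexOn.add_convexOn ⟨convex_univ, fun u _ v _ huv s t hs ht hst => ?_⟩
    (convexOn_penaltyDirDeriv grp α ξ μ₀ θ₀ hα hξ hμ₀)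
  have := mul_pos (mul_pos hs ht) (quadForm_pos hH (sub_ne_zero.2 huv))
  simp only [quadForm_convexCombo u v H hst, smul_eq_mul]
  linarith

/-- The quadratic part dominates the penalty part, which grows at most linearly, so a minimizer
exists; it is unique by strict convexity. -/
lemma exists_strict_min_limitCriterion (hH : H.PosDef) (hα : ∀ k, 0 ≤ α k) (hξ : ∀ k, 0 ≤ ξ k)
    (hμ₀ : 0 ≤ μ₀) : ∃ w, ∀ u, u ≠ w →
      limitCriterion H grp α ξ μ₀ θ₀ w < limitCriterion H grp α ξ μ₀ θ₀ u := by
  obtain ⟨a, ha, hquad⟩ := exists_mul_norm_sq_le_quadForm hH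
  obtain ⟨c, hc⟩ := exists_le_penaltyDirDeriv grp α ξ μ₀ θ₀ hα hξ hμ₀
  have hcoer : Tendsto (limitCriterion H grp α ξ μ₀ θ₀) (cocompact (Vec d)) atTop := by
    have h1 : Tendsto (fun x : ℝ => x * (a / 2 * x - c)) atTop atTop :=
      tendsto_id.atTop_mul_atTop₀
        (tendsto_atTop_add_const_right _ _ (tendsto_id.const_mul_atTop (by positivity)))
    refine tendsto_atTop_mono (fun u => ?_) (h1.comp (tendsto_norm_cocompact_atTop (E := Vec d)))
    rw [limitCriterion_eq]
    simp only [Function.comp_apply]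
    nlinarith [hquad u, hc u]
  obtain ⟨w, hw⟩ := (continuous_limitCriterion grp α ξ μ₀ θ₀ (H := H)).exists_forall_le hcoer
  have hsc := strictConvexOn_limitCriterion grp α ξ μ₀ θ₀ hH hα hξ hμ₀
  refine ⟨w, fun u hu => (hw u).lt_of_ne fun heq => hu ?_⟩
  exact hsc.eq_of_isMinOn (fun v _ => heq ▸ hw v) (fun v _ => hw v) trivial trivial

end Limit

/-! ### The mean ergodic theorem in `L¹` -/

section Ergodic

variable {X : Type*} [MeasurableSpace X] {μ : Measure X} {φ : X → X}

lemma memLp_birkhoffAverage {p : ℝ≥0∞} (hφ : MeasurePreserving φ μ μ)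
    {f : X → ℝ} (hf : MemLp f p μ) (T : ℕ) : MemLp (birkhoffAverage ℝ φ f T) p μ := by
  have : birkhoffAverage ℝ φ f T = (T : ℝ)⁻¹ • ∑ t ∈ Finset.range T, f ∘ φ^[t] := by
    ext x
    simp [birkhoffAverage, birkhoffSum]
  rw [this]
  exact (memLp_finsetSum' _ fun t _ => hf.comp_measurePreserving (hφ.iterate t)).const_smul _

lemma eLpNorm_birkhoffAverage_le (hφ : MeasurePreserving φ μ μ) {f : X → ℝ}
    (hf : AEStronglyMeasurable f μ) (T : ℕ) :
    eLpNorm (birkhoffAverage ℝ φ f T) 1 μ ≤ eLpNorm f 1 μ := by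
  have : birkhoffAverage ℝ φ f T = (T : ℝ)⁻¹ • ∑ t ∈ Finset.range T, f ∘ φ^[t] := by
    ext x
    simp [birkhoffAverage, birkhoffSum]
  rw [this, eLpNorm_const_smul]
  calc _ ≤ ‖(T : ℝ)⁻¹‖ₑ * ∑ t ∈ Finset.range T, eLpNorm (f ∘ φ^[t]) 1 μ := by
        gcongr
        exact eLpNorm_sum_le (fun t _ => hf.comp_measurePreserving (hφ.iterate t)) le_rfl
    _ = ‖(T : ℝ)⁻¹‖ₑ * T * eLpNorm f 1 μ := by
        simp [eLpNorm_comp_measurePreserving hf (hφ.iterate _), mul_assoc]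
    _ ≤ 1 * eLpNorm f 1 μ := by
        gcongr
        rcases eq_or_ne T 0 with rfl | hT
        · simp
        · rw [Real.enorm_eq_ofReal (by positivity), ← ENNReal.ofReal_natCast,
            ← ENNReal.ofReal_mul (by positivity), inv_mul_cancel₀ (by positivity)]
          simp
    _ = _ := one_mul _

lemma integral_birkhoffAverage (hφ : MeasurePreserving φ μ μ) {f : X → ℝ} (hf : Integrable f μ)
    {T : ℕ} (hT : T ≠ 0) : ∫ x, birkhoffAverage ℝ φ f T x ∂μ = ∫ x, f x ∂μ := by
  simp only [birkhoffAverage, birkhoffSum, smul_eq_mul]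
  rw [integral_const_mul, integral_finsetSum]
  · have : ∀ t, ∫ x, f (φ^[t] x) ∂μ = ∫ x, f x ∂μ := fun t => by
      have h := integral_map (hφ.iterate t).aemeasurable
        ((hφ.iterate t).map_eq.symm ▸ hf.aestronglyMeasurable)
      rw [(hφ.iterate t).map_eq] at h
      exact h.symm
    simp only [this, Finset.sum_const, Finset.card_range, nsmul_eq_mul]
    field_simp
  · exact fun t _ => (hφ.iterate t).integrable_comp_of_integrable hf

variable [IsProbabilityMeasure μ]

/-- The von Neumann ergodic theorem gives convergence in `L²` to a function fixed by the Koopman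
operator; by ergodicity this function is constant, and the integrals identify the constant. -/
lemma tendsto_eLpNorm_birkhoffAverage_sub_integral_of_memLp_two (hφ : Ergodic φ μ) {f : X → ℝ}
    (hf : MemLp f 2 μ) :
    Tendsto (fun T => eLpNorm (birkhoffAverage ℝ φ f T - fun _ => ∫ x, f x ∂μ) 1 μ) atTop
      (𝓝 0) := by
  have hmp := hφ.toMeasurePreserving
  set U : Lp ℝ 2 μ →L[ℝ] Lp ℝ 2 μ :=
    (Lp.compMeasurePreservingₗᵢ ℝ φ hmp).toContinuousLinearMap with hU
  have hconv := U.tendsto_birkhoffAverage_orthogonalProjection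
    (LinearIsometry.norm_toContinuousLinearMap_le _) (hf.toLp f)
  set g : Lp ℝ 2 μ := ((U.eqLocus (1 : Lp ℝ 2 μ →L[ℝ] Lp ℝ 2 μ)).orthogonalProjectionOnto
    (hf.toLp f) : Lp ℝ 2 μ) with hg
  have hgU : U g = g := ((U.eqLocus (1 : Lp ℝ 2 μ →L[ℝ] Lp ℝ 2 μ)).orthogonalProjectionOnto
    (hf.toLp f)).2
  obtain ⟨c, hc⟩ : ∃ c : ℝ, g =ᵐ[μ] fun _ => c := by
    refine hφ.ae_eq_const_of_ae_eq_comp_ae (Lp.aestronglyMeasurable g) ?_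
    have h := Lp.coeFn_compMeasurePreserving g hmp
    have h2 : Lp.compMeasurePreserving φ hmp g = g := hgU
    rw [h2] at h
    exact h.symm
  have hiter : ∀ T, birkhoffAverage ℝ U id T (hf.toLp f)
      = (memLp_birkhoffAverage hmp hf T).toLp (birkhoffAverage ℝ φ f T) := by
    intro T
    have h1 : ∀ t, U^[t] (hf.toLp f)
        = (hf.comp_measurePreserving (hmp.iterate t)).toLp (f ∘ φ^[t]) := fun t => by
      have : (⇑U)^[t] = (Lp.compMeasurePreserving (E := ℝ) (p := 2) φ hmp)^[t] := rfl
      rw [this, Lp.compMeasurePreserving_iterate, Lp.toLp_compMeasurePreserving]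
    have h2 : birkhoffAverage ℝ U id T (hf.toLp f) = (T : ℝ)⁻¹ • ∑ t ∈ Finset.range T,
        (hf.comp_measurePreserving (hmp.iterate t)).toLp (f ∘ φ^[t]) := by
      simp [birkhoffAverage, birkhoffSum, h1]
    rw [h2]
    refine Lp.ext ?_
    filter_upwards [MemLp.coeFn_toLp (memLp_birkhoffAverage hmp hf T),
      Lp.coeFn_smul (T : ℝ)⁻¹ (∑ t ∈ Finset.range T,
        (hf.comp_measurePreserving (hmp.iterate t)).toLp (f ∘ φ^[t])),
      Lp.coeFn_finsetSum (Finset.range T) fun t =>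
        (hf.comp_measurePreserving (hmp.iterate t)).toLp (f ∘ φ^[t]),
      ae_all_iff.2 fun t => MemLp.coeFn_toLp (hf.comp_measurePreserving (hmp.iterate t))]
      with x e1 e2 e3 e4
    rw [e1, e2, Pi.smul_apply, e3]
    simp [e4, birkhoffAverage, birkhoffSum]
  have hL2 : Tendsto (fun T => eLpNorm (birkhoffAverage ℝ φ f T - fun _ => c) 2 μ) atTop
      (𝓝 0) := by
    have h := (Lp.tendsto_Lp_iff_tendsto_eLpNorm' _ _).1 hconv
    refine h.congr fun T => eLpNorm_congr_ae ?_
    rw [hiter]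
    exact (MemLp.coeFn_toLp _).sub hc
  have hL1 : Tendsto (fun T => eLpNorm (birkhoffAverage ℝ φ f T - fun _ => c) 1 μ) atTop
      (𝓝 0) :=
    tendsto_of_tendsto_of_tendsto_of_le_of_le tendsto_const_nhds hL2 (fun _ => zero_le)
      fun T => eLpNorm_le_eLpNorm_of_exponent_le one_le_two
        ((memLp_birkhoffAverage hmp hf T).1.sub aestronglyMeasurable_const)
  have hfi : Integrable f μ := hf.integrable one_le_two
  have hint : Tendsto (fun T => ∫ x, birkhoffAverage ℝ φ f T x ∂μ) atTop (𝓝 (∫ _, c ∂μ)) := by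
    refine tendsto_integral_of_L1' _ aestronglyMeasurable_const
      (Eventually.of_forall fun T => (memLp_birkhoffAverage hmp hf T).integrable one_le_two) hL1
  have hc' : ∫ x, f x ∂μ = c := by
    refine tendsto_nhds_unique (tendsto_const_nhds.congr' ?_) (by simpa using hint)
    filter_upwards [eventually_ne_atTop 0] with T hT
    exact (integral_birkhoffAverage hmp hfi hT).symm
  rw [hc']
  exact hL1

/-- **Mean ergodic theorem** in `L¹`: the averages of an integrable function along an ergodic
transformation converge in `L¹` to its integral. -/
theorem tendsto_eLpNorm_birkhoffAverage_sub_integral (hφ : Ergodic φ μ) {f : X → ℝ}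
    (hf : Integrable f μ) :
    Tendsto (fun T => eLpNorm (birkhoffAverage ℝ φ f T - fun _ => ∫ x, f x ∂μ) 1 μ) atTop
      (𝓝 0) := by
  have hmp := hφ.toMeasurePreserving
  rw [ENNReal.tendsto_nhds_zero]
  intro ε hε
  have hε3 : ε / 3 ≠ 0 := (ENNReal.div_pos hε.ne' (by simp)).ne'
  obtain ⟨g, hfg, -⟩ := (memLp_one_iff_integrable.2 hf).exists_simpleFunc_eLpNorm_sub_lt
    ENNReal.one_ne_top hε3
  have hg2 : MemLp g 2 μ := g.memLp_of_isFiniteMeasure 2 μ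
  have hgi : Integrable g μ := hg2.integrable one_le_two
  have hsub : AEStronglyMeasurable (f - ⇑g) μ := hf.1.sub hgi.1
  filter_upwards [(ENNReal.tendsto_nhds_zero.1
    (tendsto_eLpNorm_birkhoffAverage_sub_integral_of_memLp_two hφ hg2)) (ε / 3)
    (pos_iff_ne_zero.2 hε3)] with T hT
  have hdecomp : (birkhoffAverage ℝ φ f T - fun _ => ∫ x, f x ∂μ)
      = birkhoffAverage ℝ φ (f - ⇑g) T + (birkhoffAverage ℝ φ g T - fun _ => ∫ x, g x ∂μ)
        + fun _ => -∫ x, (f - ⇑g) x ∂μ := by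
    ext x
    simp only [birkhoffAverage_sub, Pi.sub_apply, Pi.add_apply]
    rw [integral_sub hf hgi]
    ring
  have hm1 : AEStronglyMeasurable (birkhoffAverage ℝ φ (f - ⇑g) T) μ :=
    (memLp_birkhoffAverage hmp (memLp_one_iff_integrable.2 (hf.sub hgi)) T).1
  have hm2 : AEStronglyMeasurable (birkhoffAverage ℝ φ g T - fun _ => ∫ x, g x ∂μ) μ :=
    (memLp_birkhoffAverage hmp hg2 T).1.sub aestronglyMeasurable_const
  have hconst : eLpNorm (fun _ : X => -∫ x, (f - ⇑g) x ∂μ) 1 μ ≤ eLpNorm (f - ⇑g) 1 μ := by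
    rw [eLpNorm_const _ one_ne_zero (IsProbabilityMeasure.ne_zero μ),
      eLpNorm_one_eq_lintegral_enorm]
    simpa using enorm_integral_le_lintegral_enorm (f - ⇑g)
  calc _ ≤ eLpNorm (birkhoffAverage ℝ φ (f - ⇑g) T) 1 μ
        + eLpNorm (birkhoffAverage ℝ φ g T - fun _ => ∫ x, g x ∂μ) 1 μ
        + eLpNorm (fun _ : X => -∫ x, (f - ⇑g) x ∂μ) 1 μ := by
        rw [hdecomp]
        refine (eLpNorm_add_le (hm1.add hm2) aestronglyMeasurable_const le_rfl).trans ?_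
        gcongr
        exact eLpNorm_add_le hm1 hm2 le_rfl
    _ ≤ ε / 3 + ε / 3 + ε / 3 := by
        gcongr
        · exact (eLpNorm_birkhoffAverage_le hmp hsub T).trans hfg.le
        · exact hconst.trans hfg.le
    _ = ε := ENNReal.add_thirds ε

end Ergodic

/-! ### Sums of martingale differences -/

/-- The increments of a square integrable martingale are orthogonal, so the second moment of their
sum is the sum of the second moments. -/
lemma integral_sq_sum_of_condExp_eq_zero {Ω : Type*} {mΩ : MeasurableSpace Ω} {P : Measure Ω}
    [IsProbabilityMeasure P] {ℱ : Filtration ℕ mΩ} {g : ℕ → Ω → ℝ} (hg : StronglyAdapted ℱ g)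
    (hL2 : ∀ t, MemLp (g t) 2 P) (hzero : ∀ t, P[g (t + 1) | ℱ t] =ᵐ[P] 0) (T : ℕ) :
    ∫ ω, (∑ t ∈ Finset.Icc 1 T, g t ω) ^ 2 ∂P = ∑ t ∈ Finset.Icc 1 T, ∫ ω, g t ω ^ 2 ∂P := by
  induction T with
  | zero => simp
  | succ T ih =>
    have hS : MemLp (fun ω => ∑ t ∈ Finset.Icc 1 T, g t ω) 2 P := memLp_finsetSum _ fun t _ => hL2 t
    have hSm : StronglyMeasurable[ℱ T] fun ω => ∑ t ∈ Finset.Icc 1 T, g t ω := by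
      refine Finset.stronglyMeasurable_fun_sum _ fun t ht => ?_
      exact (hg t).mono (ℱ.mono (Finset.mem_Icc.1 ht).2)
    have hprod : Integrable (fun ω => (∑ t ∈ Finset.Icc 1 T, g t ω) * g (T + 1) ω) P :=
      hS.integrable_mul (hL2 (T + 1))
    have hcross : ∫ ω, (∑ t ∈ Finset.Icc 1 T, g t ω) * g (T + 1) ω ∂P = 0 := by
      have h := condExp_mul_of_stronglyMeasurable_left hSm hprod
        ((hL2 (T + 1)).integrable one_le_two)
      rw [← integral_condExp (ℱ.le T)]
      refine integral_eq_zero_of_ae ?_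
      filter_upwards [h, hzero T] with ω h1 h2
      refine h1.trans ?_
      simp [h2]
    simp only [Finset.sum_Icc_succ_top (Nat.le_add_left 1 T), add_sq]
    rw [integral_add, integral_add, ih]
    · simp only [mul_assoc, integral_const_mul, hcross]
      simp
    · exact hS.integrable_sq
    · simpa only [mul_assoc] using hprod.const_mul 2
    · exact hS.integrable_sq.add (by simpa only [mul_assoc] using hprod.const_mul 2)
    · exact (hL2 (T + 1)).integrable_sq

/-! ### Second order expansion of the loss -/

section Taylor

lemma abs_taylor_two_remainder_le {E : Type*} [NormedAddCommGroup E] [NormedSpace ℝ E]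
    {f : E → ℝ} {x v : E} {B : ℝ} (hf : ∀ t ∈ Set.Icc (0 : ℝ) 1, ContDiffAt ℝ 3 f (x + t • v))
    (hB : ∀ t ∈ Set.Icc (0 : ℝ) 1, |iteratedFDeriv ℝ 3 f (x + t • v) fun _ => v| ≤ B) :
    |f (x + v) - f x - fderiv ℝ f x v - 1 / 2 * iteratedFDeriv ℝ 2 f x fun _ => v| ≤ B := by
  have h := map_add_eq_sum_add_integral_iteratedFDeriv (n := 2) (f := f) (x := x) (y := v)
    (fun t ht => (hf t ht).of_le (by norm_num))
  have hint : |∫ t in (0 : ℝ)..1, (1 - t) ^ 2 • iteratedFDeriv ℝ (2 + 1) f (x + t • v) fun _ => v|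
      ≤ B := by
    have := intervalIntegral.norm_integral_le_of_norm_le_const (a := (0 : ℝ)) (b := 1) (C := B)
      (f := fun t => (1 - t) ^ 2 • iteratedFDeriv ℝ (2 + 1) f (x + t • v) fun _ => v) ?_
    · simpa using this
    · intro t ht
      rw [Set.uIoc_of_le zero_le_one] at ht
      have hb := hB t ⟨ht.1.le, ht.2⟩
      rw [norm_smul, Real.norm_eq_abs, Real.norm_eq_abs, abs_of_nonneg (sq_nonneg _)]
      calc _ ≤ 1 * |iteratedFDeriv ℝ 3 f (x + t • v) fun _ => v| := by
            gcongr
            nlinarith [ht.1, ht.2]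
        _ ≤ B := by linarith
  simp only [Finset.sum_range_succ, Finset.range_zero, Finset.sum_empty, Nat.factorial,
    iteratedFDeriv_zero_apply, iteratedFDeriv_one_apply, smul_eq_mul] at h
  have habs : |f (x + v) - f x - fderiv ℝ f x v - 1 / 2 * iteratedFDeriv ℝ 2 f x fun _ => v|
      = 1 / 2 * |∫ t in (0 : ℝ)..1, (1 - t) ^ 2 • iteratedFDeriv ℝ (2 + 1) f (x + t • v)
        fun _ => v| := by
    rw [← abs_of_pos (by norm_num : (0 : ℝ) < 1 / 2), ← abs_mul, h]
    congr 1
    norm_num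
    ring
  rw [habs]
  linarith [abs_nonneg (∫ t in (0 : ℝ)..1, (1 - t) ^ 2 • iteratedFDeriv ℝ (2 + 1) f (x + t • v)
    fun _ => v)]

variable {d : ℕ}

lemma sum_smul_stdVec (v : Vec d) : ∑ i, v i • stdVec i = v := by
  ext j
  simp [stdVec, Pi.single_apply]

/-- Expansion of a multilinear map on the diagonal in the canonical basis. -/
lemma multilinear_apply_diag {n : ℕ}
    (A : ContinuousMultilinearMap ℝ (fun _ : Fin n => Vec d) ℝ) (v : Vec d) :
    (A fun _ => v) = ∑ r : Fin n → Fin d, (∏ i, v (r i)) * A fun i => stdVec (r i) := by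
  conv_lhs => rw [← sum_smul_stdVec v]
  rw [ContinuousMultilinearMap.map_sum]
  simp [ContinuousMultilinearMap.map_smul_univ]

lemma iteratedFDeriv_two_diag (f : Vec d → ℝ) (x v : Vec d) :
    (iteratedFDeriv ℝ 2 f x fun _ => v)
      = ∑ i, ∑ j, v i * v j * iteratedFDeriv ℝ 2 f x ![stdVec i, stdVec j] := by
  rw [multilinear_apply_diag, ← (finTwoArrowEquiv (Fin d)).symm.sum_comp, Fintype.sum_prod_type]
  refine Finset.sum_congr rfl fun i _ => Finset.sum_congr rfl fun j _ => ?_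
  simp only [finTwoArrowEquiv_symm_apply, Fin.prod_univ_two]
  congr 2
  ext k
  fin_cases k <;> rfl

lemma fderiv_eq_inner_gradient (f : Vec d → ℝ) (x v : Vec d) :
    fderiv ℝ f x v = inner ℝ (gradient f x) v := by
  simp [gradient]

variable {N : ℕ} {l : Vec N → Vec d → ℝ} {Θ : Set (Vec d)} {θ₀ : Vec d}

lemma contDiffAt_loss (hl : ∀ x, ContDiffOn ℝ (⊤ : ℕ∞) (l x) Θ) {θ : Vec d}
    (hθ : θ ∈ interior Θ) (x : Vec N) (n : ℕ) : ContDiffAt ℝ n (l x) θ :=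
  ((hl x).contDiffAt (mem_interior_iff_mem_nhds.1 hθ)).of_le (mod_cast le_top)

/-- The remainder of the second order Taylor expansion of the loss at `θ₀` for the increment `v`. -/
noncomputable def taylorRemainder (l : Vec N → Vec d → ℝ) (θ₀ v : Vec d) (x : Vec N) : ℝ :=
  l x (θ₀ + v) - l x θ₀ - inner ℝ (score l θ₀ x) v
    - 1 / 2 * iteratedFDeriv ℝ 2 (l x) θ₀ fun _ => v

lemma ofReal_abs_thirdDeriv_le {ρ : ℝ} {θ : Vec d} (hθ : θ ∈ Metric.closedBall θ₀ ρ ∩ Θ)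
    (x : Vec N) (i j k : Fin d) :
    ENNReal.ofReal |thirdDeriv l Θ θ x i j k| ≤ thirdDerivSup l Θ θ₀ ρ x := by
  unfold thirdDerivSup
  exact le_iSup_of_le i <| le_iSup_of_le j <| le_iSup_of_le k <|
    le_iSup₂ (f := fun θ (_ : θ ∈ Metric.closedBall θ₀ ρ ∩ Θ) =>
      ENNReal.ofReal |thirdDeriv l Θ θ x i j k|) θ hθ

/-- The third derivatives bound the Taylor remainder. The supremum may be infinite at some `x`; this
is harmless because the factor in front vanishes only for `v = 0`, and then so does the
remainder. -/
lemma ofReal_abs_taylorRemainder_le (hl : ∀ x, ContDiffOn ℝ (⊤ : ℕ∞) (l x) Θ) {ρ : ℝ}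
    (hρ : Metric.closedBall θ₀ ρ ⊆ interior Θ) {v : Vec d} (hv : ‖v‖ ≤ ρ) (x : Vec N) :
    ENNReal.ofReal |taylorRemainder l θ₀ v x|
      ≤ ENNReal.ofReal (d ^ 3 * ‖v‖ ^ 3) * thirdDerivSup l Θ θ₀ ρ x := by
  have hball : ∀ t ∈ Set.Icc (0 : ℝ) 1, θ₀ + t • v ∈ Metric.closedBall θ₀ ρ := by
    intro t ht
    simp only [mem_closedBall_iff_norm, add_sub_cancel_left, norm_smul, Real.norm_of_nonneg ht.1]
    calc t * ‖v‖ ≤ 1 * ‖v‖ := by gcongr; exact ht.2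
      _ ≤ ρ := by simpa using hv
  rcases eq_or_ne (thirdDerivSup l Θ θ₀ ρ x) ⊤ with htop | htop
  · rcases eq_or_ne v 0 with rfl | hv0
    · have : (iteratedFDeriv ℝ 2 (l x) θ₀ fun _ => 0) = 0 :=
        (iteratedFDeriv ℝ 2 (l x) θ₀).map_coord_zero 0 rfl
      simp [taylorRemainder, this]
    · have hd : 0 < d := by
        rcases Nat.eq_zero_or_pos d with rfl | h
        · exact absurd (Subsingleton.elim v 0) hv0
        · exact h
      rw [htop, ENNReal.mul_top]
      · exact le_top
      · have := norm_pos_iff.2 hv0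
        exact (ENNReal.ofReal_pos.2 (by positivity)).ne'
  set D := (thirdDerivSup l Θ θ₀ ρ x).toReal with hD
  have hthird : ∀ t ∈ Set.Icc (0 : ℝ) 1, ∀ r : Fin 3 → Fin d,
      |iteratedFDeriv ℝ 3 (l x) (θ₀ + t • v) fun i => stdVec (r i)| ≤ D := by
    intro t ht r
    have hmem := hρ (hball t ht)
    have h := ofReal_abs_thirdDeriv_le (l := l) (Θ := Θ) (ρ := ρ)
      ⟨hball t ht, interior_subset hmem⟩ x (r 0) (r 1) (r 2)
    have hvec : (fun i => stdVec (r i)) = ![stdVec (r 0), stdVec (r 1), stdVec (r 2)] := by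
      ext k
      fin_cases k <;> rfl
    have hW : iteratedFDerivWithin ℝ 3 (l x) Θ (θ₀ + t • v)
        = iteratedFDeriv ℝ 3 (l x) (θ₀ + t • v) := by
      rw [← iteratedFDerivWithin_univ]
      exact iteratedFDerivWithin_congr_set (by
        rw [eventuallyEq_univ]; exact mem_interior_iff_mem_nhds.1 hmem) 3
    rw [thirdDeriv, hW, ← hvec] at h
    exact (ENNReal.ofReal_le_iff_le_toReal htop).1 h
  have hbound : ∀ t ∈ Set.Icc (0 : ℝ) 1,
      |iteratedFDeriv ℝ 3 (l x) (θ₀ + t • v) fun _ => v| ≤ d ^ 3 * ‖v‖ ^ 3 * D := by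
    intro t ht
    rw [multilinear_apply_diag]
    calc _ ≤ ∑ r : Fin 3 → Fin d, |(∏ i, v (r i)) *
          iteratedFDeriv ℝ 3 (l x) (θ₀ + t • v) fun i => stdVec (r i)| :=
          Finset.abs_sum_le_sum_abs _ _
      _ ≤ ∑ r : Fin 3 → Fin d, ‖v‖ ^ 3 * D := by
          refine Finset.sum_le_sum fun r _ => ?_
          rw [abs_mul, Finset.abs_prod]
          gcongr
          · calc _ ≤ ∏ _i : Fin 3, ‖v‖ := by
                  gcongr with i
                  exact PiLp.norm_apply_le v (r i)
              _ = _ := by simp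
          · exact hthird t ht r
      _ = _ := by
          simp
          ring
  have h := abs_taylor_two_remainder_le (f := l x) (x := θ₀) (v := v)
    (fun t ht => contDiffAt_loss hl (hρ (hball t ht)) x 3) hbound
  rw [fderiv_eq_inner_gradient] at h
  rw [← ENNReal.ofReal_toReal htop, ← ENNReal.ofReal_mul (by positivity)]
  exact ENNReal.ofReal_le_ofReal h

/-- A derivative with respect to a parameter is a limit of difference quotients along a sequence, so
it inherits measurability. -/
lemma measurable_of_hasDerivAt {X : Type*} [MeasurableSpace X] {F : ℝ → X → ℝ} {F' : X → ℝ}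
    (hF : ∀ᶠ s in 𝓝 0, Measurable (F s)) (hd : ∀ x, HasDerivAt (fun s => F s x) (F' x) 0) :
    Measurable F' := by
  have hs : Tendsto (fun n : ℕ => 1 / ((n : ℝ) + 1)) atTop (𝓝[≠] 0) :=
    tendsto_nhdsWithin_iff.2 ⟨tendsto_one_div_add_atTop_nhds_zero_nat,
      Eventually.of_forall fun n => by simp; positivity⟩
  have hs0 := hs.mono_right nhdsWithin_le_nhds
  obtain ⟨n₀, hn₀⟩ := eventually_atTop.1 (hs0.eventually hF)
  have hF0 : Measurable (F 0) := hF.self_of_nhds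
  refine measurable_of_tendsto_metrizable
    (f := fun n x => (1 / (((n + n₀ : ℕ) : ℝ) + 1))⁻¹ • (F (1 / (((n + n₀ : ℕ) : ℝ) + 1)) x - F 0 x))
    (fun n => ((hn₀ (n + n₀) (Nat.le_add_left _ _)).sub hF0).const_mul _) ?_
  refine tendsto_pi_nhds.2 fun x => ?_
  have h := (hasDerivAt_iff_tendsto_slope_zero.1 (hd x)).comp
    (hs.comp (tendsto_add_atTop_nat n₀))
  simpa [Function.comp_def] using h

lemma eventually_add_smul_mem_interior {θ : Vec d} (hθ : θ ∈ interior Θ) (v : Vec d) :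
    ∀ᶠ s : ℝ in 𝓝 0, θ + s • v ∈ interior Θ := by
  have : Tendsto (fun s : ℝ => θ + s • v) (𝓝 0) (𝓝 θ) := by
    have hc : Continuous fun s : ℝ => θ + s • v := by fun_prop
    simpa using hc.tendsto 0
  exact this.eventually (isOpen_interior.mem_nhds hθ)

lemma hasDerivAt_add_smul {E F : Type*} [NormedAddCommGroup E] [NormedSpace ℝ E]
    [NormedAddCommGroup F] [NormedSpace ℝ F] {f : E → F} {x : E}
    (hf : DifferentiableAt ℝ f x) (v : E) :
    HasDerivAt (fun s : ℝ => f (x + s • v)) (fderiv ℝ f x v) 0 := by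
  have h1 : HasDerivAt (fun s : ℝ => x + s • v) v 0 := by
    simpa using ((hasDerivAt_id (0 : ℝ)).smul_const v).const_add x
  have h2 : HasFDerivAt f (fderiv ℝ f x) (x + (0 : ℝ) • v) := by simpa using hf.hasFDerivAt
  exact h2.comp_hasDerivAt 0 h1

lemma measurable_fderiv_loss (hl_meas : ∀ θ ∈ Θ, Measurable fun x => l x θ)
    (hl : ∀ x, ContDiffOn ℝ (⊤ : ℕ∞) (l x) Θ) {θ : Vec d} (hθ : θ ∈ interior Θ) (v : Vec d) :
    Measurable fun x => fderiv ℝ (l x) θ v := by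
  refine measurable_of_hasDerivAt (F := fun s x => l x (θ + s • v)) ?_ fun x =>
    hasDerivAt_add_smul ((contDiffAt_loss hl hθ x 1).differentiableAt (by simp)) v
  filter_upwards [eventually_add_smul_mem_interior hθ v] with s hs
  exact hl_meas _ (interior_subset hs)

lemma measurable_score_inner (hl_meas : ∀ θ ∈ Θ, Measurable fun x => l x θ)
    (hl : ∀ x, ContDiffOn ℝ (⊤ : ℕ∞) (l x) Θ) (hθ₀ : θ₀ ∈ interior Θ) (v : Vec d) :
    Measurable fun x => (inner ℝ (score l θ₀ x) v : ℝ) := by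
  simpa only [fderiv_eq_inner_gradient, score] using measurable_fderiv_loss hl_meas hl hθ₀ v

lemma measurable_iteratedFDeriv_two_loss (hl_meas : ∀ θ ∈ Θ, Measurable fun x => l x θ)
    (hl : ∀ x, ContDiffOn ℝ (⊤ : ℕ∞) (l x) Θ) (hθ₀ : θ₀ ∈ interior Θ) (v : Vec d) :
    Measurable fun x => iteratedFDeriv ℝ 2 (l x) θ₀ fun _ => v := by
  simp only [iteratedFDeriv_two_apply]
  refine measurable_of_hasDerivAt (F := fun s x => fderiv ℝ (l x) (θ₀ + s • v) v) ?_ fun x => ?_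
  · filter_upwards [eventually_add_smul_mem_interior hθ₀ v] with s hs
    exact measurable_fderiv_loss hl_meas hl hs v
  · have h : DifferentiableAt ℝ (fderiv ℝ (l x)) θ₀ :=
      ((contDiffAt_loss hl hθ₀ x 2).fderiv_right (m := 1) (by norm_num)).differentiableAt (by simp)
    exact (hasDerivAt_add_smul h v).clm_apply (hasDerivAt_const 0 v) |>.congr_deriv (by simp)

lemma measurable_taylorRemainder (hl_meas : ∀ θ ∈ Θ, Measurable fun x => l x θ)
    (hl : ∀ x, ContDiffOn ℝ (⊤ : ℕ∞) (l x) Θ) (hθ₀ : θ₀ ∈ interior Θ) {v : Vec d}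
    (hv : θ₀ + v ∈ Θ) : Measurable (taylorRemainder l θ₀ v) :=
  (((hl_meas _ hv).sub (hl_meas _ (interior_subset hθ₀))).sub
    (measurable_score_inner hl_meas hl hθ₀ v)).sub
      ((measurable_iteratedFDeriv_two_loss hl_meas hl hθ₀ v).const_mul _)

end Taylor

/-! ### Averages along a stationary ergodic process -/

section StationaryAverages

variable {Ω : Type*} [mΩ : MeasurableSpace Ω] {P : Measure Ω} {N : ℕ} {ε : ℕ → Ω → Vec N}

lemma StationaryErgodic.identDistrib (h : StationaryErgodic ε P) (hε : ∀ t, Measurable (ε t))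
    (t : ℕ) : IdentDistrib (ε t) (ε 0) P P := by
  refine ⟨(hε t).aemeasurable, (hε 0).aemeasurable, ?_⟩
  have hΦ : Measurable fun ω t => ε t ω := measurable_pi_lambda _ hε
  induction t with
  | zero => rfl
  | succ t ih =>
    rw [← ih]
    have hshift := h.toMeasurePreserving
    have h1 : ∀ s, (P.map fun ω t => ε t ω).map (fun x => x s) = P.map (ε s) := fun s =>
      Measure.map_map (measurable_pi_apply s) hΦ
    rw [← h1 (t + 1), ← h1 t]
    conv_rhs => rw [← hshift.map_eq]
    rw [Measure.map_map (measurable_pi_apply t) hshift.measurable]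
    rfl

lemma shift_iterate {E : Type*} (x : ℕ → E) (n s : ℕ) :
    (fun (x : ℕ → E) t => x (t + 1))^[n] x s = x (s + n) := by
  induction n generalizing x with
  | zero => rfl
  | succ n ih => rw [Function.iterate_succ_apply, ih]; congr 1

variable [IsProbabilityMeasure P]

/-- The mean ergodic theorem on the path space, read for the process itself. -/
lemma StationaryErgodic.tendsto_eLpNorm_average (h : StationaryErgodic ε P)
    (hε : ∀ t, Measurable (ε t)) {f : Vec N → ℝ} (hf : Measurable f)
    (hfi : Integrable (fun ω => f (ε 0 ω)) P) :
    Tendsto (fun T : ℕ => eLpNorm (fun ω => (1 / (T : ℝ)) * ∑ t ∈ Finset.Icc 1 T, f (ε t ω)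
      - ∫ ω, f (ε 0 ω) ∂P) 1 P) atTop (𝓝 0) := by
  have hΦ : Measurable fun ω t => ε t ω := measurable_pi_lambda _ hε
  have hmp : MeasurePreserving (fun ω t => ε t ω) P (P.map fun ω t => ε t ω) :=
    ⟨hΦ, rfl⟩
  have : IsProbabilityMeasure (P.map fun ω t => ε t ω) :=
    Measure.isProbabilityMeasure_map hΦ.aemeasurable
  have hF : Measurable fun x : ℕ → Vec N => f (x 1) := hf.comp (measurable_pi_apply 1)
  have hid := (h.identDistrib hε 1).comp hf
  have hF1 : Integrable (fun ω => f (ε 1 ω)) P := hid.integrable_iff.2 hfi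
  have hFi : Integrable (fun x : ℕ → Vec N => f (x 1)) (P.map fun ω t => ε t ω) :=
    (integrable_map_measure hF.aestronglyMeasurable hΦ.aemeasurable).2 hF1
  have hint : ∫ x, f (x 1) ∂(P.map fun ω t => ε t ω) = ∫ ω, f (ε 0 ω) ∂P := by
    rw [integral_map hΦ.aemeasurable hF.aestronglyMeasurable]
    exact hid.integral_eq
  have key := tendsto_eLpNorm_birkhoffAverage_sub_integral h hFi
  refine key.congr fun T => ?_
  rw [hint, ← eLpNorm_comp_measurePreserving ((memLp_birkhoffAverage h.toMeasurePreserving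
    (memLp_one_iff_integrable.2 hFi) T).1.sub aestronglyMeasurable_const) hmp]
  congr 1
  ext ω
  simp only [Function.comp_apply, Pi.sub_apply, birkhoffAverage, birkhoffSum, shift_iterate,
    smul_eq_mul, one_div]
  rw [Finset.range_eq_Ico, Finset.sum_Ico_add (fun t => f (ε t ω)) 0 T 1, zero_add,
    Finset.Ico_add_one_right_eq_Icc]

/-- The score enters only through `γ_T⁻¹ ∑_{t ≤ T} ⟨∇l(ε_t; θ₀), u⟩`, whose second moment is of
order `T / γ_T²`. -/
lemma tendsto_eLpNorm_martingaleDifference_sum {ℱ : Filtration ℕ mΩ} {g : ℕ → Ω → ℝ}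
    (hg : StronglyAdapted ℱ g) (hL2 : ∀ t, MemLp (g t) 2 P)
    (hzero : ∀ t, P[g (t + 1) | ℱ t] =ᵐ[P] 0) {c : ℝ} (hc : ∀ t, ∫ ω, g t ω ^ 2 ∂P = c)
    {gam : ℕ → ℝ} (h_rate : Tendsto (fun T : ℕ => gam T / Real.sqrt (T : ℝ)) atTop atTop) :
    Tendsto (fun T : ℕ => eLpNorm (fun ω => (gam T)⁻¹ * ∑ t ∈ Finset.Icc 1 T, g t ω) 1 P) atTop
      (𝓝 0) := by
  have hS : ∀ T : ℕ, MemLp (fun ω => (gam T)⁻¹ * ∑ t ∈ Finset.Icc 1 T, g t ω) 2 P := fun T =>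
    (memLp_finsetSum _ fun t _ => hL2 t).const_mul _
  have hsq : Tendsto (fun T : ℕ => ((gam T / Real.sqrt T)⁻¹) ^ 2 * c) atTop (𝓝 0) := by
    simpa using ((tendsto_inv_atTop_zero.comp h_rate).pow 2).mul_const c
  have hnorm : Tendsto (fun T : ℕ => ENNReal.ofReal ((((gam T / Real.sqrt T)⁻¹) ^ 2 * c)
      ^ (2 : ℝ)⁻¹)) atTop (𝓝 0) := by
    have := ENNReal.tendsto_ofReal (hsq.rpow_const (p := (2 : ℝ)⁻¹) (Or.inr (by norm_num)))
    simpa using this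
  refine tendsto_of_tendsto_of_tendsto_of_le_of_le tendsto_const_nhds hnorm (fun _ => zero_le)
    fun T => (eLpNorm_le_eLpNorm_of_exponent_le one_le_two (hS T).1).trans (le_of_eq ?_)
  rw [(hS T).eLpNorm_eq_integral_rpow_norm two_ne_zero ENNReal.ofNat_ne_top]
  congr 2
  simp only [ENNReal.toReal_ofNat, Real.rpow_two, Real.norm_eq_abs, sq_abs, mul_pow]
  rw [integral_const_mul, integral_sq_sum_of_condExp_eq_zero hg hL2 hzero]
  simp only [hc, Finset.sum_const, Nat.card_Icc, Nat.add_sub_cancel, nsmul_eq_mul]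
  rw [inv_div, div_pow, Real.sq_sqrt (Nat.cast_nonneg T)]
  ring

end StationaryAverages

/-! ### The Taylor remainder along the process -/

section Local

variable {Ω : Type*} [mΩ : MeasurableSpace Ω] {P : Measure Ω} {N d m : ℕ}
  {ε : ℕ → Ω → Vec N} {l : Vec N → Vec d → ℝ} {Θ : Set (Vec d)} {θ₀ : Vec d}

/-- Only a lower integral of the third derivatives is involved, so their measurability plays no
role. -/
lemma exists_radius_lintegral_thirdDerivSup_lt_top [IsProbabilityMeasure P]
    (hθ₀ : θ₀ ∈ interior Θ) {ν : ℕ → ℝ} (hν_pos : ∀ T, 1 ≤ T → 0 < ν T)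
    (hν : Tendsto ν atTop (𝓝 0)) {C : ℝ} (hC : 0 < C)
    (h_third : ∀ T, 1 ≤ T → thirdDerivMoment l Θ θ₀ ε P (ν T * C) T < ⊤) :
    ∃ ρ, 0 < ρ ∧ Metric.closedBall θ₀ ρ ⊆ interior Θ ∧
      ∫⁻ ω, thirdDerivSup l Θ θ₀ ρ (ε 1 ω) ∂P < ⊤ := by
  obtain ⟨ρ₀, hρ₀, hball⟩ := Metric.isOpen_iff.1 isOpen_interior θ₀ hθ₀
  have hνC : Tendsto (fun T => ν T * C) atTop (𝓝 0) := by simpa using hν.mul_const C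
  obtain ⟨T, hT1, hTρ⟩ := ((eventually_ge_atTop 1).and (hνC.eventually_lt_const hρ₀)).exists
  refine ⟨ν T * C, mul_pos (hν_pos T hT1) hC,
    (Metric.closedBall_subset_ball hTρ).trans hball, ?_⟩
  set D : Ω → ℝ≥0∞ := fun ω => thirdDerivSup l Θ θ₀ (ν T * C) (ε 1 ω) with hD
  -- the term `t = t' = 1` of the moment condition
  have hsq : ∫⁻ ω, D ω * D ω ∂P < ⊤ := by
    have h := h_third T hT1
    unfold thirdDerivMoment at h
    have hmem : 1 ∈ Finset.Icc 1 T := Finset.mem_Icc.2 ⟨le_rfl, hT1⟩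
    have hinv : ((T : ℝ≥0∞) ^ 2)⁻¹ ≠ 0 := by simp
    refine lt_of_le_of_lt ?_ (ENNReal.lt_top_of_mul_ne_top_right h.ne hinv)
    refine le_trans ?_ (Finset.single_le_sum (fun _ _ => zero_le) hmem)
    exact Finset.single_le_sum (f := fun t' => ∫⁻ ω, D ω
      * thirdDerivSup l Θ θ₀ (ν T * C) (ε t' ω) ∂P) (fun _ _ => zero_le) hmem
  -- `D ≤ 1 + D²` replaces Hölder's inequality, which Mathlib states for measurable functions
  calc ∫⁻ ω, D ω ∂P ≤ ∫⁻ ω, 1 + D ω * D ω ∂P := by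
        refine lintegral_mono fun ω => ?_
        rcases le_total (D ω) 1 with h | h
        · exact h.trans le_self_add
        · exact (le_mul_of_one_le_left' h).trans le_add_self
    _ = 1 + ∫⁻ ω, D ω * D ω ∂P := by
        rw [lintegral_add_left measurable_const]
        simp
    _ < ⊤ := ENNReal.add_lt_top.2 ⟨ENNReal.one_lt_top, hsq⟩

/-- By the third order bound, the averaged Taylor remainder at distance `r` is `O(r³)` in `L¹`. -/
lemma tendsto_eLpNorm_taylorRemainder_average [IsProbabilityMeasure P]
    (h_erg : StationaryErgodic ε P) (hε : ∀ t, Measurable (ε t))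
    (hl_meas : ∀ θ ∈ Θ, Measurable fun x => l x θ)
    (hl : ∀ x, ContDiffOn ℝ (⊤ : ℕ∞) (l x) Θ) (hθ₀ : θ₀ ∈ interior Θ) {ρ : ℝ}
    (hρ0 : 0 < ρ) (hρ : Metric.closedBall θ₀ ρ ⊆ interior Θ)
    (hD : ∫⁻ ω, thirdDerivSup l Θ θ₀ ρ (ε 1 ω) ∂P < ⊤) {r : ℕ → ℝ} (hr0 : Tendsto r atTop (𝓝 0))
    (hr : ∀ᶠ T in atTop, 0 < r T) (u : Vec d) :
    Tendsto (fun T : ℕ => eLpNorm (fun ω => (r T)⁻¹ ^ 2 * ((1 / (T : ℝ)) *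
      ∑ t ∈ Finset.Icc 1 T, taylorRemainder l θ₀ (r T • u) (ε t ω))) 1 P) atTop (𝓝 0) := by
  set K := ∫⁻ ω, thirdDerivSup l Θ θ₀ ρ (ε 1 ω) ∂P with hK
  have hlim : Tendsto (fun T => ENNReal.ofReal (r T * (d ^ 3 * ‖u‖ ^ 3)) * K) atTop (𝓝 0) := by
    have h1 := ENNReal.tendsto_ofReal (hr0.mul_const ((d : ℝ) ^ 3 * ‖u‖ ^ 3))
    have h2 := ENNReal.Tendsto.mul_const h1 (b := K) (Or.inr hD.ne)
    simpa using h2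
  have hru : Tendsto (fun T => ‖r T • u‖) atTop (𝓝 0) := by
    simpa using (hr0.smul_const u).norm
  refine tendsto_of_tendsto_of_tendsto_of_le_of_le' tendsto_const_nhds hlim
    (Eventually.of_forall fun _ => zero_le) ?_
  filter_upwards [hr, hru.eventually_le_const hρ0, eventually_ge_atTop 1] with T hrT hruT hT
  have hmemΘ : θ₀ + r T • u ∈ Θ := interior_subset (hρ (by simpa using hruT))
  have hmeas : Measurable (taylorRemainder l θ₀ (r T • u)) :=
    measurable_taylorRemainder hl_meas hl hθ₀ hmemΘ
  have hone : ∀ t, eLpNorm (fun ω => taylorRemainder l θ₀ (r T • u) (ε t ω)) 1 P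
      ≤ ENNReal.ofReal (d ^ 3 * ‖r T • u‖ ^ 3) * K := by
    intro t
    have hid : IdentDistrib (fun ω => taylorRemainder l θ₀ (r T • u) (ε t ω))
        (fun ω => taylorRemainder l θ₀ (r T • u) (ε 1 ω)) P P :=
      ((h_erg.identDistrib hε t).trans (h_erg.identDistrib hε 1).symm).comp hmeas
    rw [hid.eLpNorm_eq, eLpNorm_one_eq_lintegral_enorm, hK,
      ← lintegral_const_mul' _ _ ENNReal.ofReal_ne_top]
    refine lintegral_mono fun ω => ?_
    rw [← ofReal_norm, Real.norm_eq_abs]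
    exact ofReal_abs_taylorRemainder_le hl hρ hruT (ε 1 ω)
  have hTpos : (0 : ℝ) < T := by exact_mod_cast hT
  have hfun : (fun ω => (r T)⁻¹ ^ 2 * ((1 / (T : ℝ)) *
      ∑ t ∈ Finset.Icc 1 T, taylorRemainder l θ₀ (r T • u) (ε t ω)))
      = ((r T)⁻¹ ^ 2 * (1 / (T : ℝ))) • ∑ t ∈ Finset.Icc 1 T,
        fun ω => taylorRemainder l θ₀ (r T • u) (ε t ω) := by
    ext ω
    simp [mul_assoc]
  rw [hfun, eLpNorm_const_smul]
  calc _ ≤ ‖(r T)⁻¹ ^ 2 * (1 / (T : ℝ))‖ₑ * ∑ t ∈ Finset.Icc 1 T,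
        ENNReal.ofReal (d ^ 3 * ‖r T • u‖ ^ 3) * K := by
        gcongr
        refine (eLpNorm_sum_le (fun t _ => (hmeas.comp (hε t)).aestronglyMeasurable) le_rfl).trans ?_
        exact Finset.sum_le_sum fun t _ => hone t
    _ = ENNReal.ofReal (((r T)⁻¹ ^ 2 * (1 / (T : ℝ))) * (T * (d ^ 3 * ‖r T • u‖ ^ 3))) * K := by
        rw [Real.enorm_eq_ofReal (by positivity), ENNReal.ofReal_mul (p := _ * _) (by positivity),
          ENNReal.ofReal_mul (p := (T : ℝ)) (by positivity), ENNReal.ofReal_natCast]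
        simp [mul_assoc]
    _ = _ := by
        congr 2
        rw [norm_smul, Real.norm_of_nonneg hrT.le]
        field_simp

end Local

/-! ### The localized criterion and its limit -/

section Localized

variable {Ω : Type*} [mΩ : MeasurableSpace Ω] {P : Measure Ω} {N d m : ℕ}
  {ε : ℕ → Ω → Vec N} {l : Vec N → Vec d → ℝ} {Θ : Set (Vec d)} {θ₀ : Vec d}

/-- The penalized criterion in the local parameter `u = (T / γ_T) (θ - θ₀)`, centered at `θ₀` and
multiplied by `(T / γ_T)²`. -/
noncomputable def localCriterion (l : Vec N → Vec d → ℝ) (grp : Fin d → Fin m) (α ξ : Fin m → ℝ)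
    (lam gam : ℝ) (T : ℕ) (x : ℕ → Vec N) (θ₀ u : Vec d) : ℝ :=
  (gam / T)⁻¹ ^ 2 * (penalizedCriterion l grp α ξ lam gam T x (θ₀ + (gam / T) • u)
    - penalizedCriterion l grp α ξ lam gam T x θ₀)

lemma convexOn_penalizedCriterion {grp : Fin d → Fin m} {α ξ : Fin m → ℝ} (hα : ∀ k, 0 ≤ α k)
    (hξ : ∀ k, 0 ≤ ξ k) {lam gam : ℝ} (hlam : 0 ≤ lam) (hgam : 0 ≤ gam)
    (hl : ∀ x, ConvexOn ℝ Θ (l x)) (hΘ : Convex ℝ Θ) (T : ℕ) (x : ℕ → Vec N) :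
    ConvexOn ℝ Θ (penalizedCriterion l grp α ξ lam gam T x) := by
  unfold penalizedCriterion
  refine ((ConvexOn.smul (by positivity) ?_).add (ConvexOn.smul (by positivity)
    ((convexOn_l1Penalty grp α hα).subset (Set.subset_univ _) hΘ))).add (ConvexOn.smul
      (by positivity) ((convexOn_groupPenalty grp ξ hξ).subset (Set.subset_univ _) hΘ))
  refine ⟨hΘ, fun y hy z hz a b ha hb hab => ?_⟩
  simp only [smul_eq_mul, Finset.mul_sum, ← Finset.sum_add_distrib]
  exact Finset.sum_le_sum fun t _ => (hl _).2 hy hz ha hb hab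

lemma convexOn_localCriterion {grp : Fin d → Fin m} {α ξ : Fin m → ℝ} (hα : ∀ k, 0 ≤ α k)
    (hξ : ∀ k, 0 ≤ ξ k) {lam gam : ℝ} (hlam : 0 ≤ lam) (hgam : 0 ≤ gam)
    (hl : ∀ x, ConvexOn ℝ Θ (l x)) (hΘ : Convex ℝ Θ) (T : ℕ) (x : ℕ → Vec N) (θ₀ : Vec d) :
    ConvexOn ℝ {u | θ₀ + (gam / T) • u ∈ Θ} (localCriterion l grp α ξ lam gam T x θ₀) := by
  have h := (convexOn_penalizedCriterion (grp := grp) hα hξ hlam hgam hl hΘ T x).comp_affineMap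
    (AffineMap.const ℝ (Vec d) θ₀ + (gam / (T : ℝ)) • AffineMap.id ℝ (Vec d))
  have h2 := (h.add_const (-penalizedCriterion l grp α ξ lam gam T x θ₀)).smul
    (sq_nonneg (gam / (T : ℝ))⁻¹)
  exact h2

/-- Taylor decomposition of the localized criterion: a score term, a Hessian term, a remainder, and
the increments of the penalties. -/
lemma localCriterion_eq (l : Vec N → Vec d → ℝ) (grp : Fin d → Fin m) (α ξ : Fin m → ℝ)
    {lam gam : ℝ} (hgam : 0 < gam) {T : ℕ} (hT : 0 < T) (x : ℕ → Vec N) (θ₀ u : Vec d) :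
    localCriterion l grp α ξ lam gam T x θ₀ u =
      gam⁻¹ * (∑ t ∈ Finset.Icc 1 T, inner ℝ (score l θ₀ (x t)) u)
      + (1 / 2) * ((1 / (T : ℝ)) * ∑ t ∈ Finset.Icc 1 T, iteratedFDeriv ℝ 2 (l (x t)) θ₀ fun _ => u)
      + (gam / T)⁻¹ ^ 2 * ((1 / (T : ℝ)) *
          ∑ t ∈ Finset.Icc 1 T, taylorRemainder l θ₀ ((gam / T) • u) (x t))
      + (lam / gam * ((gam / T)⁻¹ * (l1Penalty grp α (θ₀ + (gam / T) • u) - l1Penalty grp α θ₀))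
        + (gam / T)⁻¹ * (groupPenalty grp ξ (θ₀ + (gam / T) • u) - groupPenalty grp ξ θ₀)) := by
  have hT' : (0 : ℝ) < T := by exact_mod_cast hT
  set r := gam / (T : ℝ) with hr
  have hr0 : 0 < r := by positivity
  have hg : gam = r * T := by rw [hr]; field_simp
  have h2 : ∀ f : Vec d → ℝ, (iteratedFDeriv ℝ 2 f θ₀ fun _ => r • u)
      = r ^ 2 * iteratedFDeriv ℝ 2 f θ₀ fun _ => u := fun f => by
    have := (iteratedFDeriv ℝ 2 f θ₀).map_smul_univ (fun _ => r) (fun _ => u)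
    simpa [sq] using this
  simp only [taylorRemainder, Finset.sum_sub_distrib, ← Finset.mul_sum, h2, inner_smul_right]
  unfold localCriterion penalizedCriterion
  rw [← hr]
  rw [hg]
  field_simp
  ring

lemma integral_iteratedFDeriv_two [IsProbabilityMeasure P]
    (hH_int : ∀ i j, Integrable (fun ω => secondDeriv l θ₀ (ε 0 ω) i j) P) (u : Vec d) :
    Integrable (fun ω => iteratedFDeriv ℝ 2 (l (ε 0 ω)) θ₀ fun _ => u) P ∧
      ∫ ω, (iteratedFDeriv ℝ 2 (l (ε 0 ω)) θ₀ fun _ => u) ∂P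
        = u.ofLp ⬝ᵥ (hessianMean l ε P θ₀ *ᵥ u.ofLp) := by
  have h : ∀ ω, (iteratedFDeriv ℝ 2 (l (ε 0 ω)) θ₀ fun _ => u)
      = ∑ i, ∑ j, u i * u j * secondDeriv l θ₀ (ε 0 ω) i j := fun ω =>
    iteratedFDeriv_two_diag _ _ _
  have hi : ∀ i j, Integrable (fun ω => u i * u j * secondDeriv l θ₀ (ε 0 ω) i j) P :=
    fun i j => (hH_int i j).const_mul _
  simp only [h]
  refine ⟨integrable_finsetSum _ fun i _ => integrable_finsetSum _ fun j _ => hi i j, ?_⟩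
  rw [integral_finsetSum _ fun i _ => integrable_finsetSum _ fun j _ => hi i j]
  simp only [integral_finsetSum _ fun j _ => hi _ j, integral_const_mul, dotProduct,
    Matrix.mulVec, hessianMean, Matrix.of_apply, Finset.mul_sum]
  refine Finset.sum_congr rfl fun i _ => Finset.sum_congr rfl fun j _ => by ring

/-- Pointwise convergence in `L¹` of the localized criterion to the limit criterion. -/
theorem tendsto_eLpNorm_localCriterion_sub_limitCriterion [IsProbabilityMeasure P]
    {ℱ : Filtration ℕ mΩ} (hl_meas : ∀ θ ∈ Θ, Measurable fun x => l x θ)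
    (grp : Fin d → Fin m) (α ξ : Fin m → ℝ) {lam gam : ℕ → ℝ}
    (h_erg : StationaryErgodic ε P) (hε : ∀ t, Measurable (ε t)) (hθ₀ : θ₀ ∈ interior Θ)
    (hl : ∀ x, ContDiffOn ℝ (⊤ : ℕ∞) (l x) Θ)
    (h_mds : IsSqIntegrableMartingaleDifference (fun t ω => score l θ₀ (ε t ω)) ℱ P)
    (hH_int : ∀ i j, Integrable (fun ω => secondDeriv l θ₀ (ε 0 ω) i j) P)
    {ρ : ℝ} (hρ0 : 0 < ρ) (hρ : Metric.closedBall θ₀ ρ ⊆ interior Θ)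
    (hD : ∫⁻ ω, thirdDerivSup l Θ θ₀ ρ (ε 1 ω) ∂P < ⊤) {μ₀ : ℝ}
    (hgam : ∀ᶠ T in atTop, 0 < gam T)
    (h_rate₁ : Tendsto (fun T : ℕ => gam T / (T : ℝ)) atTop (𝓝 0))
    (h_rate₂ : Tendsto (fun T : ℕ => gam T / Real.sqrt (T : ℝ)) atTop atTop)
    (h_rate₃ : Tendsto (fun T : ℕ => lam T / gam T) atTop (𝓝 μ₀)) (u : Vec d) :
    Tendsto (fun T : ℕ => eLpNorm (fun ω =>
      localCriterion l grp α ξ (lam T) (gam T) T (fun t => ε t ω) θ₀ u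
        - limitCriterion (hessianMean l ε P θ₀) grp α ξ μ₀ θ₀ u) 1 P) atTop (𝓝 0) := by
  have hrpos : ∀ᶠ T : ℕ in atTop, 0 < gam T / (T : ℝ) := by
    filter_upwards [hgam, eventually_ge_atTop 1] with T h1 h2
    have : (0 : ℝ) < T := by exact_mod_cast h2
    positivity
  -- the score term
  have hscore_meas := measurable_score_inner hl_meas hl hθ₀ u
  have hscore := tendsto_eLpNorm_martingaleDifference_sum (ℱ := ℱ) (P := P)
    (g := fun t ω => inner ℝ (score l θ₀ (ε t ω)) u)
    (fun t => (h_mds.adapted t).inner stronglyMeasurable_const)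
    (fun t => (h_mds.memLp t).inner_const u)
    (fun t => by
      have h := (innerSL ℝ u).comp_condExp_comm (m := ℱ t)
        ((h_mds.memLp (t + 1)).integrable one_le_two)
      have h' : (fun ω => inner ℝ (score l θ₀ (ε (t + 1) ω)) u)
          = innerSL ℝ u ∘ fun ω => score l θ₀ (ε (t + 1) ω) := by
        ext ω
        simp [real_inner_comm]
      rw [h']
      filter_upwards [h, h_mds.condExp_eq_zero t] with ω h1 h2
      rw [← h1]
      simp [h2])
    (c := ∫ ω, (inner ℝ (score l θ₀ (ε 0 ω)) u : ℝ) ^ 2 ∂P)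
    (fun t => ((h_erg.identDistrib hε t).comp (hscore_meas.pow_const 2)).integral_eq) h_rate₂
  -- the Hessian term
  have hq_meas := measurable_iteratedFDeriv_two_loss hl_meas hl hθ₀ u
  obtain ⟨hq_int, hq_eq⟩ := integral_iteratedFDeriv_two (P := P) hH_int u
  have hhess := h_erg.tendsto_eLpNorm_average hε hq_meas hq_int
  rw [hq_eq] at hhess
  -- the remainder
  have hrem := tendsto_eLpNorm_taylorRemainder_average h_erg hε hl_meas hl hθ₀ hρ0 hρ hD
    h_rate₁ hrpos u
  -- the penalties
  have hr_right : Tendsto (fun T : ℕ => gam T / (T : ℝ)) atTop (𝓝[>] 0) :=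
    tendsto_nhdsWithin_iff.2 ⟨h_rate₁, hrpos⟩
  have hpen := (h_rate₃.mul ((tendsto_l1Penalty_slope grp α θ₀ u).comp hr_right)).add
    ((tendsto_groupPenalty_slope grp ξ θ₀ u).comp hr_right)
  set b : ℕ → ℝ := fun T => lam T / gam T * ((gam T / T)⁻¹ * (l1Penalty grp α
    (θ₀ + (gam T / T) • u) - l1Penalty grp α θ₀)) + (gam T / T)⁻¹ * (groupPenalty grp ξ
      (θ₀ + (gam T / T) • u) - groupPenalty grp ξ θ₀) with hb
  have hpen' : Tendsto (fun T => ‖b T - penaltyDirDeriv grp α ξ μ₀ θ₀ u‖ₑ) atTop (𝓝 0) := by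
    have h1 : Tendsto b atTop (𝓝 (penaltyDirDeriv grp α ξ μ₀ θ₀ u)) := hpen
    have h2 := (h1.sub_const (penaltyDirDeriv grp α ξ μ₀ θ₀ u)).enorm
    simpa using h2
  have hsum := ((hscore.add (ENNReal.Tendsto.const_mul hhess
    (Or.inr (enorm_ne_top (x := (1 / 2 : ℝ)))))).add
    hrem).add hpen'
  simp only [mul_zero, add_zero] at hsum
  refine tendsto_of_tendsto_of_tendsto_of_le_of_le' tendsto_const_nhds hsum
    (Eventually.of_forall fun _ => zero_le) ?_
  have hru : Tendsto (fun T : ℕ => ‖(gam T / (T : ℝ)) • u‖) atTop (𝓝 0) := by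
    simpa using (h_rate₁.smul_const u).norm
  filter_upwards [hgam, eventually_ge_atTop 1, hru.eventually_le_const hρ0] with T hgT hT hruT
  have hmemΘ : θ₀ + (gam T / (T : ℝ)) • u ∈ Θ := interior_subset (hρ (by simpa using hruT))
  have hrem_meas := measurable_taylorRemainder hl_meas hl hθ₀ hmemΘ
  have hm1 : Measurable fun ω => (gam T)⁻¹ * ∑ t ∈ Finset.Icc 1 T,
      (inner ℝ (score l θ₀ (ε t ω)) u : ℝ) :=
    (Finset.measurable_fun_sum _ fun t _ => hscore_meas.comp (hε t)).const_mul _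
  have hm2 : Measurable fun ω => (1 / (T : ℝ)) * ∑ t ∈ Finset.Icc 1 T,
      (iteratedFDeriv ℝ 2 (l (ε t ω)) θ₀ fun _ => u)
        - u.ofLp ⬝ᵥ (hessianMean l ε P θ₀ *ᵥ u.ofLp) :=
    ((Finset.measurable_fun_sum _ fun t _ => hq_meas.comp (hε t)).const_mul _).sub_const _
  have hm3 : Measurable fun ω => (gam T / T)⁻¹ ^ 2 * ((1 / (T : ℝ)) *
      ∑ t ∈ Finset.Icc 1 T, taylorRemainder l θ₀ ((gam T / T) • u) (ε t ω)) :=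
    ((Finset.measurable_fun_sum _ fun t _ => hrem_meas.comp (hε t)).const_mul _).const_mul _
  set f1 : Ω → ℝ := fun ω => (gam T)⁻¹ * ∑ t ∈ Finset.Icc 1 T,
      (inner ℝ (score l θ₀ (ε t ω)) u : ℝ) with hf1
  set f2 : Ω → ℝ := fun ω => (1 / (T : ℝ)) * ∑ t ∈ Finset.Icc 1 T,
      (iteratedFDeriv ℝ 2 (l (ε t ω)) θ₀ fun _ => u)
        - u.ofLp ⬝ᵥ (hessianMean l ε P θ₀ *ᵥ u.ofLp) with hf2
  set f3 : Ω → ℝ := fun ω => (gam T / T)⁻¹ ^ 2 * ((1 / (T : ℝ)) *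
      ∑ t ∈ Finset.Icc 1 T, taylorRemainder l θ₀ ((gam T / T) • u) (ε t ω)) with hf3
  have hdecomp : (fun ω => localCriterion l grp α ξ (lam T) (gam T) T (fun t => ε t ω) θ₀ u
      - limitCriterion (hessianMean l ε P θ₀) grp α ξ μ₀ θ₀ u)
      = f1 + (1 / 2 : ℝ) • f2 + f3 + fun _ => b T - penaltyDirDeriv grp α ξ μ₀ θ₀ u := by
    ext ω
    rw [localCriterion_eq l grp α ξ hgT hT, limitCriterion_eq]
    simp only [hf1, hf2, hf3, hb, Pi.add_apply, Pi.smul_apply, smul_eq_mul]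
    ring
  have hs1 := hm1.aestronglyMeasurable (μ := P)
  have hs2 := (hm2.const_smul (1 / 2 : ℝ)).aestronglyMeasurable (μ := P)
  have hs3 := hm3.aestronglyMeasurable (μ := P)
  rw [hdecomp]
  refine (eLpNorm_add_le ((hs1.add hs2).add hs3) aestronglyMeasurable_const le_rfl).trans ?_
  refine add_le_add ?_ (by simp [eLpNorm_const _ one_ne_zero (IsProbabilityMeasure.ne_zero P)])
  refine (eLpNorm_add_le (hs1.add hs2) hs3 le_rfl).trans ?_
  refine add_le_add ?_ le_rfl
  refine (eLpNorm_add_le hs1 hs2 le_rfl).trans ?_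
  rw [eLpNorm_const_smul]

lemma eventually_measurable_localCriterion (hl_meas : ∀ θ ∈ Θ, Measurable fun x => l x θ)
    (hε : ∀ t, Measurable (ε t)) (hθ₀ : θ₀ ∈ interior Θ) (grp : Fin d → Fin m) (α ξ : Fin m → ℝ)
    {lam gam : ℕ → ℝ} (h_rate : Tendsto (fun T : ℕ => gam T / (T : ℝ)) atTop (𝓝 0)) (u : Vec d) :
    ∀ᶠ T : ℕ in atTop, Measurable fun ω =>
      localCriterion l grp α ξ (lam T) (gam T) T (fun t => ε t ω) θ₀ u := by
  filter_upwards [h_rate.eventually (eventually_add_smul_mem_interior hθ₀ u)] with T hT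
  have h : ∀ θ ∈ Θ, Measurable fun ω =>
      penalizedCriterion l grp α ξ (lam T) (gam T) T (fun t => ε t ω) θ := fun θ hθ =>
    (((Finset.measurable_fun_sum _ fun t _ => (hl_meas θ hθ).comp (hε t)).const_mul _).add_const
      _).add_const _
  exact ((h _ (interior_subset hT)).sub (h _ (interior_subset hθ₀))).const_mul _

end Localized

end SparseGroupLasso

theorem mainTheorem7
    {Ω : Type*} [mΩ : MeasurableSpace Ω] (P : Measure Ω) [IsProbabilityMeasure P]
    (N d m : ℕ)
    -- the process, the parameter set and the loss
    (ε : ℕ → Ω → SparseGroupLasso.Vec N) (ℱ : Filtration ℕ mΩ)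
    (Θ : Set (SparseGroupLasso.Vec d)) (θ₀ : SparseGroupLasso.Vec d)
    (l : SparseGroupLasso.Vec N → SparseGroupLasso.Vec d → ℝ)
    (hl_meas : ∀ θ ∈ Θ, Measurable fun x => l x θ)
    -- the groups, the weights and the tuning parameters
    (grp : Fin d → Fin m) (α ξ : Fin m → ℝ) (hα : ∀ k, 0 ≤ α k) (hξ : ∀ k, 0 ≤ ξ k)
    (lam gam : ℕ → ℝ) (hlam : ∀ T, 0 ≤ lam T) (hgam : ∀ T, 0 ≤ gam T)
    -- strict stationarity, ergodicity, non-anticipation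
    (h_erg : SparseGroupLasso.StationaryErgodic ε P) (h_adapted : StronglyAdapted ℱ ε)
    -- the parameter set is convex and the true parameter is interior to it
    (hΘ : Convex ℝ Θ) (hθ₀ : θ₀ ∈ interior Θ)
    -- the loss is strictly convex and smooth in the parameter
    (hl_conv : ∀ x, StrictConvexOn ℝ Θ (l x)) (hl_smooth : ∀ x, ContDiffOn ℝ (⊤ : ℕ∞) (l x) Θ)
    -- the expected loss is finite and uniquely minimized at the true parameter
    (hl_int : ∀ θ ∈ Θ, Integrable (fun ω => l (ε 0 ω) θ) P)
    (h_min : ∀ θ ∈ Θ, θ ≠ θ₀ → ∫ ω, l (ε 0 ω) θ₀ ∂P < ∫ ω, l (ε 0 ω) θ ∂P)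
    -- the score at the true parameter is a square integrable martingale difference
    (h_mds : SparseGroupLasso.IsSqIntegrableMartingaleDifference
      (fun t ω => SparseGroupLasso.score l θ₀ (ε t ω)) ℱ P)
    -- the matrices `ℍ` and `𝕄` exist and are positive definite
    (hH_int : ∀ i j, Integrable (fun ω => SparseGroupLasso.secondDeriv l θ₀ (ε 0 ω) i j) P)
    (hH : (SparseGroupLasso.hessianMean l ε P θ₀).PosDef)
    (hM_int : ∀ i j, Integrable (fun ω => SparseGroupLasso.score l θ₀ (ε 0 ω) i
      * SparseGroupLasso.score l θ₀ (ε 0 ω) j) P)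
    (hM : (SparseGroupLasso.scoreSecondMoment l ε P θ₀).PosDef)
    -- the moment condition on the third derivatives
    (ν : ℕ → ℝ) (hν_pos : ∀ T, 1 ≤ T → 0 < ν T) (hν : Tendsto ν atTop (𝓝 0))
    (C : ℝ) (hC : 0 < C)
    (h_third : ∀ T, 1 ≤ T →
      SparseGroupLasso.thirdDerivMoment l Θ θ₀ ε P (ν T * C) T < ⊤)
    -- the penalized estimator
    (θhat : ℕ → Ω → SparseGroupLasso.Vec d) (hθhat_meas : ∀ T, AEMeasurable (θhat T) P)
    (hθhat : ∀ T, 1 ≤ T → ∀ᵐ ω ∂P, θhat T ω ∈ Θ ∧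
      IsMinOn (SparseGroupLasso.penalizedCriterion l grp α ξ (lam T) (gam T) T
        fun t => ε t ω) Θ (θhat T ω))
    -- the rates of the tuning parameters
    (μ₀ : ℝ) (hμ₀ : 0 ≤ μ₀)
    (h_rate₁ : Tendsto (fun T : ℕ => gam T / (T : ℝ)) atTop (𝓝 0))
    (h_rate₂ : Tendsto (fun T : ℕ => gam T / Real.sqrt (T : ℝ)) atTop atTop)
    (h_rate₃ : Tendsto (fun T : ℕ => lam T / gam T) atTop (𝓝 μ₀)) :
    ConvexOn ℝ Set.univ (SparseGroupLasso.limitCriterion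
      (SparseGroupLasso.hessianMean l ε P θ₀) grp α ξ μ₀ θ₀) ∧
    (∃ uStar : SparseGroupLasso.Vec d,
      (∀ u, u ≠ uStar →
        SparseGroupLasso.limitCriterion
            (SparseGroupLasso.hessianMean l ε P θ₀) grp α ξ μ₀ θ₀ uStar
          < SparseGroupLasso.limitCriterion
            (SparseGroupLasso.hessianMean l ε P θ₀) grp α ξ μ₀ θ₀ u) ∧
      TendstoInDistribution (fun (T : ℕ) ω => ((T : ℝ) / gam T) • (θhat T ω - θ₀)) atTop
        (fun _ : Ω => uStar) (fun _ => P) P ∧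
      TendstoInMeasure P (fun (T : ℕ) ω => ((T : ℝ) / gam T) • (θhat T ω - θ₀)) atTop
        (fun _ : Ω => uStar)) ∧
    (fun T : ℕ => (T : ℝ) / gam T) =o[atTop] (fun T : ℕ => Real.sqrt (T : ℝ)) := by
  have hε : ∀ t, Measurable (ε t) := fun t => ((h_adapted t).mono (ℱ.le t)).measurable
  have hgam_pos : ∀ᶠ T in atTop, 0 < gam T := by
    filter_upwards [h_rate₂.eventually_gt_atTop 0] with T hT
    refine (hgam T).lt_of_ne fun h => ?_
    rw [← h, zero_div] at hT
    exact lt_irrefl _ hT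
  obtain ⟨uStar, huStar⟩ :=
    SparseGroupLasso.exists_strict_min_limitCriterion grp α ξ μ₀ θ₀ hH hα hξ hμ₀
  obtain ⟨ρ, hρ0, hρ, hD⟩ := SparseGroupLasso.exists_radius_lintegral_thirdDerivSup_lt_top
    hθ₀ hν_pos hν hC h_third
  have hmeasure : TendstoInMeasure P (fun (T : ℕ) ω => ((T : ℝ) / gam T) • (θhat T ω - θ₀)) atTop
      (fun _ : Ω => uStar) := by
    refine SparseGroupLasso.tendstoInMeasure_argmin_of_convexOn
      (SparseGroupLasso.continuous_limitCriterion grp α ξ μ₀ θ₀) huStar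
      (fun T ω => SparseGroupLasso.convexOn_localCriterion hα hξ (hlam T) (hgam T)
        (fun x => (hl_conv x).convexOn) hΘ T (fun t => ε t ω) θ₀)
      (fun p => ?_)
      (SparseGroupLasso.eventually_measurable_localCriterion hl_meas hε hθ₀ grp α ξ h_rate₁)
      (SparseGroupLasso.tendsto_eLpNorm_localCriterion_sub_limitCriterion hl_meas grp α ξ h_erg hε
        hθ₀ hl_smooth h_mds hH_int hρ0 hρ hD hgam_pos h_rate₁ h_rate₂ h_rate₃) ?_
    · filter_upwards [h_rate₁.eventually
        (SparseGroupLasso.eventually_add_smul_mem_interior hθ₀ p)] with T hT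
      exact interior_subset hT
    · filter_upwards [hgam_pos, eventually_ge_atTop 1] with T hgT hT
      have hT' : (0 : ℝ) < T := by exact_mod_cast hT
      filter_upwards [hθhat T hT] with ω hω
      have hback : θ₀ + (gam T / T) • ((T : ℝ) / gam T) • (θhat T ω - θ₀) = θhat T ω := by
        rw [smul_smul, div_mul_div_cancel₀ hT'.ne', div_self hgT.ne', one_smul]
        abel
      refine ⟨?_, fun u hu => ?_⟩
      · rw [← hback] at hω
        exact hω.1
      · have hmin := hω.2 hu
        simp only [Set.mem_ofPred_eq] at hmin
        change SparseGroupLasso.localCriterion _ _ _ _ _ _ _ _ _ _ ≤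
          SparseGroupLasso.localCriterion _ _ _ _ _ _ _ _ _ _
        unfold SparseGroupLasso.localCriterion
        rw [hback]
        gcongr
  refine ⟨(SparseGroupLasso.strictConvexOn_limitCriterion grp α ξ μ₀ θ₀ hH hα hξ hμ₀).convexOn,
    ⟨uStar, huStar, hmeasure.tendstoInDistribution fun T => ?_, hmeasure⟩, ?_⟩
  · have h := ((hθhat_meas T).sub_const θ₀).const_smul ((T : ℝ) / gam T)
    exact h
  · -- `(T / γ_T) / √T = (γ_T / √T)⁻¹`; at `T = 0` both sides vanish
    refine (isLittleO_iff_tendsto' ?_).2 ?_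
    · filter_upwards [eventually_ge_atTop 1] with T hT h
      have : (0 : ℝ) < T := by exact_mod_cast hT
      exact absurd h (Real.sqrt_pos.2 this).ne'
    · refine (tendsto_inv_atTop_zero.comp h_rate₂).congr fun T => ?_
      rw [Function.comp_apply, inv_div, div_right_comm, Real.div_sqrt]
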